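/- Let $\mathbb{S}^2\subset\mathbb{R}^3$ be the unit sphere with surface measure $dS$. For a (real) tangent vector field $u$ let $u^\perp$ denote its rotation by $-90^\circ$ in the tangent planes ($u^\perp=(u_2,-u_1)$ in positively oriented orthonormal frames), let $\operatorname{div}u$ be the (weak) divergence of $u$, and set $\operatorname{rot}u:=\operatorname{div}(u^\perp)$. Let $H^1(T\mathbb{S}^2)$ be the space of tangent vector fields in $L^2(T\mathbb{S}^2)$ with weak covariant derivative in $L^2$; for such $u$ the functions $\operatorname{div}u$ and $\operatorname{rot}u$ exist in $L^2(\mathbb{S}^2)$. Let $\|\cdot\|$ be the norm of $L^2(\mathbb{S}^2)$. **Theorem.** Let $N\ge 0$, let $u_1,\dots,u_N\in H^1(T\mathbb{S}^2)$ be orthonormal in $L^2(T\mathbb{S}^2)$, and let $\rho(s)=\sum_{j=1}^N|u_j(s)|^2$. Then $\rho\in L^2(\mathbb{S}^2)$ and $$\int_{\mathbb{S}^2}\rho(s)^2\,dS\le\frac{3\pi}{16}\sum_{j=1}^N\bigl(\|\operatorname{rot}u_j\|^2+\|\operatorname{div}u_j\|^2\bigr).$$ If, in addition, $\operatorname{div}u_j=0$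 for all $j$, then $$\int_{\mathbb{S}^2}\rho(s)^2\,dS\le\frac{3\pi}{32}\sum_{j=1}^N\|\operatorname{rot}u_j\|^2,$$ and if instead $\operatorname{rot}u_j=0$ for all $j$, then $$\int_{\mathbb{S}^2}\rho(s)^2\,dS\le\frac{3\pi}{32}\sum_{j=1}^N\|\operatorname{div}u_j\|^2.$$ -/

import Mathlib

open MeasureTheory
open scoped ContDiff

noncomputable section

namespace SphereLT

/-- Euclidean three-space. -/
abbrev E3 : Type := EuclideanSpace ℝ (Fin 3)

/-- The unit sphere `𝕊²` in `ℝ³`. -/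
abbrev S2 : Type := Metric.sphere (0 : E3) 1

/-- The surface measure `dS` of `𝕊²` (total mass `4π`). -/
def dS : Measure S2 := (volume : Measure E3).toSphere

/-- The orthogonal projection of `ℝ³` onto the tangent plane `T_s 𝕊² = s^⊥`. -/
def tangentProj (s : S2) (v : E3) : E3 := v - inner ℝ (s : E3) v • (s : E3)

/-- The rotation `u^⊥ = (u₂, -u₁)` in positively oriented orthonormal frames of the tangent planes
(orientation by the outer normal), extrinsically `u^⊥(s) = u(s) × s`. -/
def perp (u : S2 → E3) (s : S2) : E3 :=
  WithLp.toLp 2 (crossProduct (WithLp.ofLp (u s)) (WithLp.ofLp (s : E3)))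

/-- The gradient on `𝕊²` of (the restriction to `𝕊²` of) a smooth function `φ`.
The smooth functions on `𝕊²` are exactly the restrictions of smooth functions on `ℝ³`, and the
value depends on that restriction only. -/
def surfGrad (φ : E3 → ℝ) (s : S2) : E3 := tangentProj s (gradient φ (s : E3))

/-- Smooth tangent vector fields on `𝕊²`, as restrictions of smooth maps of `ℝ³`. -/
structure IsSmoothTangent (X : E3 → E3) : Prop where
  smooth : ContDiff ℝ ∞ X
  tangent : ∀ s : S2, inner ℝ (X s) (s : E3) = 0

/-- The divergence on `𝕊²` of a smooth tangent vector field: the trace over the tangent plane of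
its derivative, that is, the full trace without the normal-normal entry. -/
def surfDiv (X : E3 → E3) (s : S2) : ℝ :=
  LinearMap.trace ℝ E3 (fderiv ℝ X (s : E3) : E3 →ₗ[ℝ] E3)
    - inner ℝ (fderiv ℝ X (s : E3) (s : E3)) (s : E3)

/-- The Levi-Civita covariant derivative `∇_X Y` of smooth tangent vector fields on `𝕊²`. -/
def covDeriv (X Y : E3 → E3) (s : S2) : E3 :=
  tangentProj s (fderiv ℝ Y (s : E3) (X (s : E3)))

/-- `u ∈ L²(T𝕊²)`. -/
structure IsL2Field (u : S2 → E3) : Prop where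
  memLp : MemLp u 2 dS
  tangent : ∀ᵐ s ∂dS, inner ℝ (u s) (s : E3) = 0

/-- `T` is the weak covariant derivative of the vector field `u`: a field of endomorphisms of the
tangent planes (extended by zero to the normal line) such that, for all smooth tangent fields
`X`, `Y`, `∫ ⟨∇_X u, Y⟩ dS = -∫ (⟨u, ∇_X Y⟩ + ⟨u, Y⟩ div X) dS`, where `∇_X u = T X`. -/
structure IsWeakCovDeriv (u : S2 → E3) (T : S2 → E3 →L[ℝ] E3) : Prop where
  tangent : ∀ᵐ s ∂dS, T s (s : E3) = 0 ∧ ∀ v : E3, inner ℝ (T s v) (s : E3) = 0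
  byParts : ∀ X Y : E3 → E3, IsSmoothTangent X → IsSmoothTangent Y →
    ∫ s, inner ℝ (T s (X s)) (Y s) ∂dS
      = -∫ s, (inner ℝ (u s) (covDeriv X Y s) + inner ℝ (u s) (Y s) * surfDiv X s) ∂dS

/-- `u ∈ H¹(T𝕊²)`: `u` is in `L²(T𝕊²)` and has a square integrable weak covariant derivative. -/
def IsH1Field (u : S2 → E3) : Prop :=
  IsL2Field u ∧ ∃ T : S2 → E3 →L[ℝ] E3, MemLp T 2 dS ∧ IsWeakCovDeriv u T

/-- `g` is the weak divergence of the tangent vector field `u`, and is in `L²(𝕊²)`: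
`∫ g φ dS = -∫ ⟨u, ∇φ⟩ dS` for every smooth function `φ`. -/
structure IsWeakDiv (u : S2 → E3) (g : S2 → ℝ) : Prop where
  memLp : MemLp g 2 dS
  byParts : ∀ φ : E3 → ℝ, ContDiff ℝ ∞ φ →
    ∫ s, g s * φ s ∂dS = -∫ s, inner ℝ (u s) (surfGrad φ s) ∂dS

open Classical in
/-- `div u` for a vector field with weak divergence in `L²(𝕊²)`, in particular for every `u` in
`H¹(T𝕊²)`; it is unique up to null sets (and set to `0` where there is none). -/
def divS (u : S2 → E3) : S2 → ℝ :=
  if h : ∃ g : S2 → ℝ, IsWeakDiv u g then h.choose else 0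

/-- `rot u = div (u^⊥)`. -/
def rotS (u : S2 → E3) : S2 → ℝ := divS (perp u)

theorem divS_spec {u : S2 → E3} {g : S2 → ℝ} (h : IsWeakDiv u g) : IsWeakDiv u (divS u) := by
  have h' : ∃ g : S2 → ℝ, IsWeakDiv u g := ⟨g, h⟩
  rw [divS, dif_pos h']
  exact h'.choose_spec

end SphereLT

end

/-!
This is the Lieb–Thirring inequality for vector fields on the sphere, proved by Rumin's method with
the spectral cut-off of Frank, Hundertmark, Jex and Nam.

Let `u₁, …, u_N` be orthonormal and expand them in an orthonormal basis `e` of eigenfields, with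
eigenvalues `λ = n (n + 1)`, `n ≥ 1`, and coefficients `c`. For an energy `E > 0` put
`f(E/λ) = (1 + (π E / (4 λ))²)⁻¹` and let `u^E` be the sum of the `f(E/λ) c e`. The normalisation of
`f` is `∫₀^∞ f(E/λ)² dE = λ`, so `∫₀^∞ ∑ ‖u_j^E‖² dE = ∑ λ c²`. The rest `u - u^E` is controlled
pointwise: by Bessel's inequality for the orthonormal family `u`, the sum over `j` of
`|u_j - u_j^E|²` at a point `s` is at most `∑ (1 - f(E/λ))² |e(s)|²`, and this is at most `A E`.
The triangle inequality `√ρ ≤ (∑ |u_j^E|²)^{1/2} + √(A E)`, integrated over `0 < E < ρ/A`, gives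
`ρ² ≤ 6 A ∫₀^∞ ∑ |u_j^E|² dE` (`norm_pow_four_le`), and integration over the sphere gives
`∫ ρ² ≤ 6 A ∑ λ c²` (`integral_partialSum_le`). All this is done for finite partial sums of the
expansions, and Fatou's lemma leads to the limit.

The eigenfields are of two kinds, `(x × ∇) Y` and `x × (x × ∇) Y`, the latter being minus the
surface gradient of `Y`, divided by `√λ`, where `Y` runs through an orthonormal basis of spherical
harmonics. Each kind contributes
`∑ |e(s)|² ≤ (2 n + 1) / 4π` in degree `n` (`sum_norm_sq_vecHarm`), and
`∑ (2 n + 1) (1 - f(E/λ_n))² ≤ π² E / 16` (`sum_mul_cutoff_sq_le`); so `A = π / 64` for each kind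
that occurs, and `6 A = 3π / 32`. The products `√λ c` are, up to sign, the scalar coefficients of
`rot u` and `div u` at `Y`, so `∑ λ c²` is at most `‖rot u‖² + ‖div u‖²`. If `div u` or `rot u`
vanishes, only one kind occurs.

The analysis on the sphere rests on the angular derivatives `x × ∇` of polynomials. By rotation
invariance of the surface measure they are antisymmetric (`integral_res_angD`); the sum `lap` of
their squares acts on polynomials of degree `n` as `-n (n + 1)` up to lower degree
(`lap_add_smul_mem`). Hence the polynomials of degree `n` orthogonal to those of lower degree are
eigenfunctions. That the two kinds of eigenfields are complete follows from a polynomial identity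
(`lap_smul_decomposition`): it shows that a tangent field orthogonal to all of them has weakly
harmonic, thus constant, cartesian components, and a constant vector that is tangent everywhere
vanishes.
-/

namespace SphereLT

open MvPolynomial Filter
open scoped Topology

/-! ### Angular derivatives of polynomials -/

/-- Real polynomials in the three coordinates of `ℝ³`. -/
abbrev Pol : Type := MvPolynomial (Fin 3) ℝ

/-- The angular derivative `(x × ∇)ᵢ = xᵢ₊₁ ∂ᵢ₊₂ - xᵢ₊₂ ∂ᵢ₊₁`, indices modulo `3`. -/
noncomputable def angD (i : Fin 3) : Derivation ℝ Pol Pol :=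
  (X (i + 1) : Pol) • pderiv (i + 2) - (X (i + 2) : Pol) • pderiv (i + 1)

theorem angD_apply (i : Fin 3) (p : Pol) :
    angD i p = X (i + 1) * pderiv (i + 2) p - X (i + 2) * pderiv (i + 1) p := by
  simp [angD]

/-- The components of `x × (x × ∇) p`, which on the sphere is minus the surface gradient of `p`. -/
noncomputable def negGrad (i : Fin 3) (p : Pol) : Pol :=
  X (i + 1) * angD (i + 2) p - X (i + 2) * angD (i + 1) p

/-- The sum of the squares of the angular derivatives: on the sphere, the Laplace–Beltrami
operator. -/
noncomputable def lap : Pol →ₗ[ℝ] Pol := ∑ i, (angD i).toLinearMap ∘ₗ (angD i).toLinearMap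

theorem lap_apply (p : Pol) : lap p = ∑ i, angD i (angD i p) := by
  simp [lap]

/-- The Laplacian of `ℝ³`. -/
noncomputable def flatLap : Pol →ₗ[ℝ] Pol :=
  ∑ i, (pderiv i : Derivation ℝ Pol Pol).toLinearMap ∘ₗ
    (pderiv i : Derivation ℝ Pol Pol).toLinearMap

theorem flatLap_apply (p : Pol) : flatLap p = ∑ i, pderiv i (pderiv i p) := by
  simp [flatLap]

/-- The polynomial `|x|²`. -/
noncomputable def normSqPol : Pol := ∑ i : Fin 3, (X i : Pol) ^ 2

theorem pderiv_pderiv_comm (i j : Fin 3) (p : Pol) :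
    pderiv i (pderiv j p) = pderiv j (pderiv i p) := by
  have h : ⁅(pderiv i : Derivation ℝ Pol Pol), (pderiv j : Derivation ℝ Pol Pol)⁆ = 0 := by
    apply MvPolynomial.derivation_ext
    intro k
    simp [Derivation.commutator_apply, pderiv_X, Pi.single_apply, apply_ite]
  have := congrArg (fun D : Derivation ℝ Pol Pol => D p) h
  simpa [Derivation.commutator_apply, sub_eq_zero] using this

/-- The angular part of the Laplacian of `ℝ³`, in terms of the Euler operator `∑ xᵢ ∂ᵢ`. -/
theorem lap_eq_euler (p : Pol) :
    lap p = normSqPol * flatLap p - ∑ j, X j * pderiv j (∑ i, X i * pderiv i p)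
      - ∑ i, X i * pderiv i p := by
  simp only [lap_apply, flatLap_apply, normSqPol, Fin.sum_univ_three, angD_apply]
  simp [pderiv_X]
  rw [pderiv_pderiv_comm 1 0, pderiv_pderiv_comm 2 0, pderiv_pderiv_comm 2 1]
  ring

/-- The field `(lap p) eⱼ` is, modulo normal fields, a sum of a field `x × ∇a` and of a field
`x × (x × ∇b)`. -/
theorem lap_smul_decomposition (i j : Fin 3) (p : Pol) :
    ((if i = j then normSqPol else 0) - X i * X j) * lap p
      = normSqPol * angD i (angD j p) + negGrad i (negGrad j p) := by
  simp only [lap_apply, normSqPol, negGrad, Fin.sum_univ_three, angD_apply]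
  fin_cases i <;> fin_cases j <;>
  · simp [pderiv_X]
    rw [pderiv_pderiv_comm 1 0, pderiv_pderiv_comm 2 0, pderiv_pderiv_comm 2 1]
    ring

theorem sum_X_mul_angD (p : Pol) : ∑ i, X i * angD i p = 0 := by
  simp only [Fin.sum_univ_three, angD_apply]
  simp
  ring

theorem sum_X_mul_negGrad (p : Pol) : ∑ i, X i * negGrad i p = 0 := by
  simp only [Fin.sum_univ_three, negGrad]
  simp
  ring

theorem sum_angD_negGrad (p : Pol) : ∑ i, angD i (negGrad i p) = 0 := by
  simp only [negGrad, Fin.sum_univ_three, angD_apply]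
  simp [pderiv_X]
  rw [pderiv_pderiv_comm 1 0, pderiv_pderiv_comm 2 0, pderiv_pderiv_comm 2 1]
  ring

theorem sum_negGrad_mul_negGrad (p q : Pol) :
    ∑ i, negGrad i p * negGrad i q = normSqPol * ∑ i, angD i p * angD i q := by
  have h1 := sum_X_mul_angD p
  have h2 := sum_X_mul_angD q
  have : ∑ i, negGrad i p * negGrad i q = normSqPol * (∑ i, angD i p * angD i q)
      - (∑ i, X i * angD i p) * ∑ i, X i * angD i q := by
    simp only [negGrad, normSqPol, Fin.sum_univ_three]
    simp
    ring
  rw [this, h1, zero_mul, sub_zero]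

theorem lap_sq (p : Pol) : lap (p * p) = 2 * (p * lap p + ∑ i, angD i p * angD i p) := by
  simp only [lap_apply, Fin.sum_univ_three]
  simp
  ring

theorem restrictTotalDegree_le {n : ℕ} {T : Submodule ℝ Pol}
    (h : ∀ k ≤ n, ∀ q : Pol, q.IsHomogeneous k → q ∈ T) : restrictTotalDegree (Fin 3) ℝ n ≤ T := by
  intro p hp
  rw [mem_restrictTotalDegree] at hp
  rw [← sum_homogeneousComponent p]
  refine Submodule.sum_mem _ fun k hk => h k ?_ _ (homogeneousComponent_isHomogeneous k p)
  have := Finset.mem_range.mp hk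
  omega

theorem mem_restrictTotalDegree_of_isHomogeneous {k n : ℕ} (h : k ≤ n) {q : Pol}
    (hq : q.IsHomogeneous k) : q ∈ restrictTotalDegree (Fin 3) ℝ n :=
  (mem_restrictTotalDegree _ _ _).mpr (hq.totalDegree_le.trans h)

theorem angD_mem (i : Fin 3) {n : ℕ} {p : Pol} (hp : p ∈ restrictTotalDegree (Fin 3) ℝ n) :
    angD i p ∈ restrictTotalDegree (Fin 3) ℝ n := by
  revert p
  suffices restrictTotalDegree (Fin 3) ℝ n ≤
      (restrictTotalDegree (Fin 3) ℝ n).comap (angD i).toLinearMap from fun p hp => this hp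
  refine restrictTotalDegree_le fun k hk q hq => ?_
  change angD i q ∈ restrictTotalDegree (Fin 3) ℝ n
  rcases k with _ | k
  · rw [← totalDegree_zero_iff_isHomogeneous, totalDegree_eq_zero_iff_eq_C] at hq
    rw [hq, show (C (coeff 0 q) : Pol) = algebraMap ℝ Pol (coeff 0 q) from rfl,
      Derivation.map_algebraMap]
    exact Submodule.zero_mem _
  · refine mem_restrictTotalDegree_of_isHomogeneous hk ?_
    rw [angD_apply, add_comm k 1]
    exact ((isHomogeneous_X _ _).mul hq.pderiv).sub ((isHomogeneous_X _ _).mul hq.pderiv)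

/-- Modulo polynomials that vanish on the sphere, `lap` acts on the top degree `n + 1` as
multiplication by `-(n + 1) (n + 2)`. -/
theorem lap_add_smul_mem {n : ℕ} {p : Pol} (hp : p ∈ restrictTotalDegree (Fin 3) ℝ (n + 1)) :
    lap p + (((n : ℝ) + 1) * (n + 2)) • p - (normSqPol - 1) * flatLap p
      ∈ restrictTotalDegree (Fin 3) ℝ n := by
  revert p
  suffices restrictTotalDegree (Fin 3) ℝ (n + 1) ≤ (restrictTotalDegree (Fin 3) ℝ n).comap
      (lap + (((n : ℝ) + 1) * (n + 2)) • LinearMap.id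
        - LinearMap.mulLeft ℝ (normSqPol - 1) ∘ₗ flatLap) from fun p hp => this hp
  refine restrictTotalDegree_le fun k hk q hq => ?_
  change lap q + (((n : ℝ) + 1) * (n + 2)) • q - (normSqPol - 1) * flatLap q
    ∈ restrictTotalDegree (Fin 3) ℝ n
  have h1 := hq.sum_X_mul_pderiv
  have h2 : ∑ j, X j * pderiv j (∑ i, X i * pderiv i q) = (k * k : ℝ) • q := by
    rw [h1, mul_smul]
    simp_rw [← Nat.cast_smul_eq_nsmul ℝ, Derivation.map_smul, mul_smul_comm, ← Finset.smul_sum, h1,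
      ← Nat.cast_smul_eq_nsmul ℝ]
  have h3 : lap q + (((n : ℝ) + 1) * (n + 2)) • q - (normSqPol - 1) * flatLap q
      = flatLap q + (((n : ℝ) + 1) * (n + 2) - k * (k + 1)) • q := by
    rw [lap_eq_euler, h2, h1, ← Nat.cast_smul_eq_nsmul ℝ, sub_mul, one_mul]
    module
  rw [h3]
  refine Submodule.add_mem _ ?_ ?_
  · rw [flatLap_apply]
    exact Submodule.sum_mem _ fun i _ =>
      mem_restrictTotalDegree_of_isHomogeneous (by omega) hq.pderiv.pderiv
  · rcases Nat.lt_or_ge n k with h | h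
    · obtain rfl : k = n + 1 := by omega
      have : ((n : ℝ) + 1) * (n + 2) - ((n + 1 : ℕ) : ℝ) * (((n + 1 : ℕ) : ℝ) + 1) = 0 := by
        push_cast; ring
      rw [this, zero_smul]
      exact Submodule.zero_mem _
    · exact Submodule.smul_mem _ _ (mem_restrictTotalDegree_of_isHomogeneous h hq)

/-! ### Integration of polynomials over the sphere -/

instance : IsFiniteMeasure dS := inferInstanceAs (IsFiniteMeasure (volume : Measure E3).toSphere)

instance : dS.IsOpenPosMeasure :=
  inferInstanceAs (volume : Measure E3).toSphere.IsOpenPosMeasure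

theorem dS_real_univ : dS.real Set.univ = 4 * Real.pi := by
  rw [dS, Measure.toSphere_real_apply_univ, measureReal_def, EuclideanSpace.volume_ball_fin_three]
  simp
  rw [ENNReal.toReal_ofReal (by positivity)]
  ring

/-- The action of a linear isometry of `ℝ³` on the sphere. -/
noncomputable def sphereMap (f : E3 ≃ₗᵢ[ℝ] E3) (s : S2) : S2 := ⟨f s, by simp⟩

theorem continuous_sphereMap (f : E3 ≃ₗᵢ[ℝ] E3) : Continuous (sphereMap f) := by
  unfold sphereMap
  fun_prop

open scoped Pointwise in
theorem measurePreserving_sphereMap (f : E3 ≃ₗᵢ[ℝ] E3) : MeasurePreserving (sphereMap f) dS dS := by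
  refine ⟨(continuous_sphereMap f).measurable, ?_⟩
  ext t ht
  rw [Measure.map_apply (continuous_sphereMap f).measurable ht, dS, Measure.toSphere_apply' _ ht,
    Measure.toSphere_apply' _ ((continuous_sphereMap f).measurable ht)]
  congr 1
  have h : Set.Ioo (0 : ℝ) 1 • ((↑) '' (sphereMap f ⁻¹' t) : Set E3)
      = f ⁻¹' (Set.Ioo (0 : ℝ) 1 • ((↑) '' t : Set E3)) := by
    ext x
    simp only [Set.mem_smul, Set.mem_image, Set.mem_preimage]
    constructor
    · rintro ⟨r, hr, _, ⟨s, hs, rfl⟩, rfl⟩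
      exact ⟨r, hr, f s, ⟨sphereMap f s, hs, rfl⟩, by simp⟩
    · rintro ⟨r, hr, _, ⟨s, hs, rfl⟩, hx⟩
      refine ⟨r, hr, f.symm s, ⟨⟨f.symm s, by simp⟩, ?_, rfl⟩, ?_⟩
      · simpa [sphereMap] using hs
      · apply f.injective
        simpa using hx
  rw [h]
  exact f.measurePreserving.measure_preimage_equiv (f := f.toMeasurableEquiv) _

/-- Restriction of polynomials to the sphere. -/
noncomputable def res : Pol →ₐ[ℝ] C(S2, ℝ) :=
  aeval fun i => ⟨fun s : S2 => (s : E3) i, by fun_prop⟩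

theorem res_apply (p : Pol) (s : S2) : res p s = eval (fun i => (s : E3) i) p := by
  induction p using MvPolynomial.induction_on with
  | C a => simp [res]
  | add p q hp hq => simp [hp, hq]
  | mul_X p i hp => simp [hp]; simp [res]

@[simp]
theorem res_X (i : Fin 3) (s : S2) : res (X i) s = (s : E3) i := by
  simp [res_apply]

theorem sum_sq_sphere (s : S2) : ∑ i, (s : E3) i ^ 2 = 1 := by
  have h : ‖(s : E3)‖ = 1 := by simp
  have := EuclideanSpace.real_norm_sq_eq (s : E3)
  rw [← this, h]; norm_num

@[simp]
theorem res_normSqPol : res normSqPol = 1 := by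
  ext s
  simpa [normSqPol] using sum_sq_sphere s

theorem integrable_continuousMap {F : Type*} [NormedAddCommGroup F] (f : C(S2, F)) :
    Integrable (fun s => f s) dS :=
  f.continuous.integrable_of_hasCompactSupport (HasCompactSupport.of_compactSpace _)

/-- The rotation by the angle `t` about the coordinate axis `i`. Its orbits are the flow lines of
the angular derivative `angD i`, see `hasDerivAt_res_axisRotation`. -/
noncomputable def axisRotation (i : Fin 3) (t : ℝ) : E3 ≃ₗᵢ[ℝ] E3 :=
  LinearIsometry.toLinearIsometryEquiv
    { toFun := fun x => WithLp.toLp 2 fun k =>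
        if k = i then x i
        else if k = i + 1 then Real.cos t * x (i + 1) - Real.sin t * x (i + 2)
        else Real.sin t * x (i + 1) + Real.cos t * x (i + 2)
      map_add' := fun x y => by
        ext k
        simp only [PiLp.add_apply]
        split_ifs <;> ring
      map_smul' := fun c x => by
        ext k
        simp only [PiLp.smul_apply, smul_eq_mul, RingHom.id_apply]
        split_ifs <;> ring
      norm_map' := fun x => by
        have h := Real.sin_sq_add_cos_sq t
        rw [EuclideanSpace.norm_eq, EuclideanSpace.norm_eq]
        congr 1
        simp only [LinearMap.coe_mk, AddHom.coe_mk, Real.norm_eq_abs, sq_abs, Fin.sum_univ_three]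
        fin_cases i <;> simp
        · linear_combination (x 1 ^ 2 + x 2 ^ 2) * h
        · linear_combination (x 2 ^ 2 + x 0 ^ 2) * h
        · linear_combination (x 0 ^ 2 + x 1 ^ 2) * h }
    rfl

theorem axisRotation_apply (i : Fin 3) (t : ℝ) (x : E3) (k : Fin 3) :
    axisRotation i t x k =
        if k = i then x i
        else if k = i + 1 then Real.cos t * x (i + 1) - Real.sin t * x (i + 2)
        else Real.sin t * x (i + 1) + Real.cos t * x (i + 2) := rfl

theorem hasDerivAt_res_axisRotation (i : Fin 3) (p : Pol) (s : S2) (t : ℝ) :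
    HasDerivAt (fun t => res p (sphereMap (axisRotation i t) s))
      (res (angD i p) (sphereMap (axisRotation i t) s)) t := by
  induction p using MvPolynomial.induction_on with
  | C a =>
    have : angD i (C a) = 0 := (angD i).map_algebraMap a
    simpa [this, res_apply] using hasDerivAt_const t a
  | add p q hp hq => simpa using hp.fun_add hq
  | mul_X p k hp =>
    have hX : HasDerivAt (fun t => res (X k) (sphereMap (axisRotation i t) s))
        (res (angD i (X k)) (sphereMap (axisRotation i t) s)) t := by
      have hc := (Real.hasDerivAt_cos t).mul_const
      have hs := (Real.hasDerivAt_sin t).mul_const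
      have hk : k = i ∨ k = i + 1 ∨ k = i + 2 :=
        (by decide : ∀ i k : Fin 3, k = i ∨ k = i + 1 ∨ k = i + 2) i k
      have h1 : i ≠ i + 1 := (by decide : ∀ i : Fin 3, i ≠ i + 1) i
      have h2 : i ≠ i + 2 := (by decide : ∀ i : Fin 3, i ≠ i + 2) i
      have h3 : i + 1 ≠ i + 2 := (by decide : ∀ i : Fin 3, i + 1 ≠ i + 2) i
      simp only [res_X, sphereMap, axisRotation_apply]
      rcases hk with rfl | rfl | rfl
      · simpa [angD_apply, pderiv_X, h1, h2] using hasDerivAt_const t _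
      · simp only [h1.symm, if_false, if_true]
        refine ((hc _).fun_sub (hs _)).congr_deriv ?_
        simp [angD_apply, pderiv_X, h3, h3.symm, axisRotation_apply, h2.symm]
        ring
      · simp only [h2.symm, h3.symm, if_false]
        refine ((hs _).fun_add (hc _)).congr_deriv ?_
        simp [angD_apply, pderiv_X, h3.symm, axisRotation_apply, h1.symm]
        ring
    simpa [mul_comm, add_comm] using hp.fun_mul hX

/-- Integration by parts on the sphere for angular derivatives, from the rotation invariance of the
surface measure. -/
theorem integral_res_angD (i : Fin 3) (p : Pol) : ∫ s, res (angD i p) s ∂dS = 0 := by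
  have h := (hasDerivAt_integral_of_dominated_loc_of_deriv_le (μ := dS) (x₀ := (0 : ℝ))
    (F := fun t s => res p (sphereMap (axisRotation i t) s))
    (F' := fun t s => res (angD i p) (sphereMap (axisRotation i t) s))
    (bound := fun _ => ‖res (angD i p)‖) (s := Set.univ) Filter.univ_mem
    (Filter.Eventually.of_forall fun t =>
      ((res p).continuous.comp (continuous_sphereMap _)).aestronglyMeasurable)
    (integrable_continuousMap ((res p).comp ⟨_, continuous_sphereMap _⟩))
    ((res (angD i p)).continuous.comp (continuous_sphereMap _)).aestronglyMeasurable
    (Filter.Eventually.of_forall fun s t _ => ContinuousMap.norm_coe_le_norm _ _)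
    (integrable_const _)
    (Filter.Eventually.of_forall fun s t _ => hasDerivAt_res_axisRotation i p s t)).2
  have hinv (q : Pol) (t : ℝ) :
      ∫ s, res q (sphereMap (axisRotation i t) s) ∂dS = ∫ s, res q s ∂dS := by
    have hm := measurePreserving_sphereMap (axisRotation i t)
    have := integral_map hm.measurable.aemeasurable (μ := dS) (f := fun s => res q s)
      (res q).continuous.aestronglyMeasurable
    rw [← this, hm.map_eq]
  simp only [hinv] at h
  exact h.unique (hasDerivAt_const _ _)

theorem integral_res_angD_mul (i : Fin 3) (p q : Pol) :
    ∫ s, res (angD i p * q) s ∂dS = -∫ s, res (p * angD i q) s ∂dS := by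
  have h := integral_res_angD i (p * q)
  rw [Derivation.leibniz, smul_eq_mul, smul_eq_mul, map_add] at h
  simp only [ContinuousMap.add_apply] at h
  rw [integral_add (integrable_continuousMap _) (integrable_continuousMap _)] at h
  rw [mul_comm (angD i p) q]
  linarith

theorem integral_res_sum {ι : Type*} (t : Finset ι) (f : ι → Pol) :
    ∫ s, res (∑ i ∈ t, f i) s ∂dS = ∑ i ∈ t, ∫ s, res (f i) s ∂dS := by
  rw [← integral_finsetSum _ fun i _ => integrable_continuousMap (res (f i))]
  simp [map_sum]

theorem integral_res_sum_angD_mul_angD (p q : Pol) :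
    ∫ s, res (∑ i, angD i p * angD i q) s ∂dS = -∫ s, res (p * lap q) s ∂dS := by
  rw [lap_apply, Finset.mul_sum, integral_res_sum, integral_res_sum, ← Finset.sum_neg_distrib]
  exact Finset.sum_congr rfl fun i _ => integral_res_angD_mul i p (angD i q)

/-! ### Spherical harmonics -/

/-- Restriction of polynomials to the sphere, as elements of `L²(𝕊²)`. -/
noncomputable def resL2 : Pol →ₗ[ℝ] Lp ℝ 2 dS :=
  (ContinuousMap.toLp 2 dS ℝ : C(S2, ℝ) →L[ℝ] Lp ℝ 2 dS).toLinearMap ∘ₗ res.toLinearMap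

theorem resL2_eq_iff {p q : Pol} : resL2 p = resL2 q ↔ res p = res q :=
  ContinuousMap.toLp_inj dS

theorem resL2_eq_zero_iff {p : Pol} : resL2 p = 0 ↔ res p = 0 := by
  rw [← map_zero resL2, resL2_eq_iff, map_zero]

theorem coeFn_resL2 (p : Pol) : resL2 p =ᵐ[dS] res p := ContinuousMap.coeFn_toLp dS (res p)

theorem inner_resL2 (p q : Pol) : inner ℝ (resL2 p) (resL2 q) = ∫ s, res (p * q) s ∂dS := by
  rw [L2.inner_def]
  refine integral_congr_ae ?_
  filter_upwards [coeFn_resL2 p, coeFn_resL2 q] with s hp hq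
  simp [hp, hq, mul_comm]

theorem inner_resL2_angD (i : Fin 3) (p q : Pol) :
    inner ℝ (resL2 (angD i p)) (resL2 q) = -inner ℝ (resL2 p) (resL2 (angD i q)) := by
  rw [inner_resL2, inner_resL2, integral_res_angD_mul]

theorem res_angD_eq_zero (i : Fin 3) {p : Pol} (h : res p = 0) : res (angD i p) = 0 := by
  rw [← resL2_eq_zero_iff] at h ⊢
  rw [← inner_self_eq_zero (𝕜 := ℝ), inner_resL2_angD, h, inner_zero_left, neg_zero]

theorem res_angD_congr (i : Fin 3) {p q : Pol} (h : res p = res q) :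
    res (angD i p) = res (angD i q) := by
  rw [← sub_eq_zero, ← map_sub, ← map_sub]
  exact res_angD_eq_zero i (by rw [map_sub, h, sub_self])

theorem res_lap_congr {p q : Pol} (h : res p = res q) : res (lap p) = res (lap q) := by
  rw [lap_apply, lap_apply, map_sum, map_sum]
  exact Finset.sum_congr rfl fun i _ => res_angD_congr i (res_angD_congr i h)

/-- Every polynomial of degree at most `n + 1` agrees on the sphere, up to a term of degree at most
`n`, with a multiple of its Laplace–Beltrami derivative. -/
theorem exists_res_lap_eq {n : ℕ} {p : Pol} (hp : p ∈ restrictTotalDegree (Fin 3) ℝ (n + 1)) :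
    ∃ r ∈ restrictTotalDegree (Fin 3) ℝ n,
      res (lap p) + (((n : ℝ) + 1) * (n + 2)) • res p = res r :=
  ⟨_, lap_add_smul_mem hp, by simp⟩

/-- The restrictions to the sphere of the polynomials of degree at most `n`. -/
noncomputable def polSpace (n : ℕ) : Submodule ℝ (Lp ℝ 2 dS) :=
  (restrictTotalDegree (Fin 3) ℝ n).map resL2

instance (n : ℕ) : FiniteDimensional ℝ (polSpace n) := by
  unfold polSpace; infer_instance

theorem restrictTotalDegree_mono {m n : ℕ} (h : m ≤ n) :
    restrictTotalDegree (Fin 3) ℝ m ≤ restrictTotalDegree (Fin 3) ℝ n := fun p hp => by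
  rw [mem_restrictTotalDegree] at hp ⊢
  exact hp.trans h

theorem polSpace_mono {m n : ℕ} (h : m ≤ n) : polSpace m ≤ polSpace n :=
  Submodule.map_mono (restrictTotalDegree_mono h)

/-- The spherical harmonics of degree `n + 1`. The constants, of degree `0`, play no role for
vector fields. -/
noncomputable def harmSpace (n : ℕ) : Submodule ℝ (Lp ℝ 2 dS) :=
  (polSpace n)ᗮ ⊓ polSpace (n + 1)

instance (n : ℕ) : FiniteDimensional ℝ (harmSpace n) :=
  Submodule.finiteDimensional_of_le (inf_le_right : harmSpace n ≤ polSpace (n + 1))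

theorem angD_mem_polSpace (i : Fin 3) {n : ℕ} {p : Pol} (hp : resL2 p ∈ polSpace n) :
    resL2 (angD i p) ∈ polSpace n := by
  obtain ⟨q, hq, hpq⟩ := hp
  rw [← resL2_eq_iff.mpr (res_angD_congr i (resL2_eq_iff.mp hpq))]
  exact ⟨_, angD_mem i hq, rfl⟩

theorem angD_mem_harmSpace (i : Fin 3) {n : ℕ} {p : Pol} (hp : resL2 p ∈ harmSpace n) :
    resL2 (angD i p) ∈ harmSpace n := by
  refine ⟨?_, angD_mem_polSpace i hp.2⟩
  rw [SetLike.mem_coe, Submodule.mem_orthogonal']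
  rintro _ ⟨q, hq, rfl⟩
  rw [inner_resL2_angD, neg_eq_zero]
  exact (Submodule.mem_orthogonal' _ _).mp hp.1 _ ⟨_, angD_mem i hq, rfl⟩

theorem res_lap_of_mem_harmSpace {n : ℕ} {p : Pol} (hp : resL2 p ∈ harmSpace n) :
    res (lap p) = -(((n : ℝ) + 1) * (n + 2)) • res p := by
  obtain ⟨q, hq, hpq⟩ := hp.2
  obtain ⟨r, hr, h⟩ := exists_res_lap_eq hq
  rw [resL2_eq_iff] at hpq
  rw [hpq, res_lap_congr hpq] at h
  have hmem : resL2 r ∈ harmSpace n := by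
    have h1 : resL2 r = resL2 (lap p + (((n : ℝ) + 1) * (n + 2)) • p) := by
      rw [resL2_eq_iff, ← h]; simp
    rw [h1, map_add, map_smul, lap_apply, map_sum]
    exact Submodule.add_mem _
      (Submodule.sum_mem _ fun i _ => angD_mem_harmSpace i (angD_mem_harmSpace i hp))
      (Submodule.smul_mem _ _ hp)
  have h0 : resL2 r = 0 := by
    rw [← inner_self_eq_zero (𝕜 := ℝ)]
    exact (Submodule.mem_orthogonal' _ _).mp hmem.1 _ ⟨r, hr, rfl⟩
  rw [resL2_eq_zero_iff] at h0
  rw [h0] at h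
  rw [neg_smul]
  exact eq_neg_of_add_eq_zero_left h

theorem monomial_mem_polSpace_sup {n : ℕ} (W : Submodule ℝ (Lp ℝ 2 dS))
    (h0 : ∀ a b, a + b = n + 1 → resL2 (X 0 ^ a * X 1 ^ b) ∈ W)
    (h1 : ∀ a b, a + b = n → resL2 (X 0 ^ a * X 1 ^ b * X 2) ∈ W) (c : ℕ) :
    ∀ a b, a + b + c = n + 1 → resL2 (X 0 ^ a * X 1 ^ b * X 2 ^ c) ∈ polSpace n ⊔ W := by
  induction c using Nat.strong_induction_on with
  | _ c ih =>
    intro a b h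
    rcases c with _ | _ | c
    · exact Submodule.mem_sup_right (by simpa using h0 a b h)
    · exact Submodule.mem_sup_right (by simpa using h1 a b (by omega))
    · have hres : resL2 (X 0 ^ a * X 1 ^ b * X 2 ^ (c + 2)) = resL2 (X 0 ^ a * X 1 ^ b * X 2 ^ c)
          - resL2 (X 0 ^ (a + 2) * X 1 ^ b * X 2 ^ c)
          - resL2 (X 0 ^ a * X 1 ^ (b + 2) * X 2 ^ c) := by
        rw [← map_sub, ← map_sub, resL2_eq_iff]
        have h1 := res_normSqPol
        simp only [normSqPol, Fin.sum_univ_three, map_add, map_pow] at h1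
        simp only [map_sub, map_mul, map_pow]
        linear_combination res (X 0) ^ a * res (X 1) ^ b * res (X 2) ^ c * h1
      rw [hres]
      refine Submodule.sub_mem _ (Submodule.sub_mem _ ?_ (ih c (by omega) _ _ (by omega)))
        (ih c (by omega) _ _ (by omega))
      refine Submodule.mem_sup_left ⟨_, mem_restrictTotalDegree_of_isHomogeneous (k := a + b + c)
        (by omega) ?_, rfl⟩
      exact ((isHomogeneous_X_pow _ _).mul (isHomogeneous_X_pow _ _)).mul (isHomogeneous_X_pow _ _)

/-- On the sphere `x₂² = 1 - x₀² - x₁²`, so modulo lower degree the polynomials of degree `n + 1`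
are spanned by the `2 n + 3` monomials whose exponent of `x₂` is at most `1`. -/
theorem finrank_harmSpace_le (n : ℕ) : Module.finrank ℝ (harmSpace n) ≤ 2 * n + 3 := by
  let m : Fin (n + 2) ⊕ Fin (n + 1) → Lp ℝ 2 dS := Sum.elim
    (fun a => resL2 (X 0 ^ (a : ℕ) * X 1 ^ (n + 1 - a : ℕ)))
    (fun a => resL2 (X 0 ^ (a : ℕ) * X 1 ^ (n - a : ℕ) * X 2))
  let W := Submodule.span ℝ (Set.range m)
  have hle : polSpace (n + 1) ≤ polSpace n ⊔ W := by
    refine Submodule.map_le_iff_le_comap.mpr (restrictTotalDegree_le fun k hk q hq => ?_)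
    rw [Submodule.mem_comap]
    rcases hk.lt_or_eq with hk | rfl
    · exact Submodule.mem_sup_left
        ⟨_, mem_restrictTotalDegree_of_isHomogeneous (Nat.lt_succ_iff.mp hk) hq, rfl⟩
    · rw [q.as_sum, map_sum]
      refine Submodule.sum_mem _ fun d hd => ?_
      have hdeg := hq.degree_eq_sum_deg_support hd
      rw [monomial_eq, Finsupp.prod_fintype _ _ (by simp), Fin.prod_univ_three, ← smul_eq_C_mul,
        map_smul]
      refine Submodule.smul_mem _ _ (monomial_mem_polSpace_sup W ?_ ?_ _ _ _ ?_)
      · intro a b h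
        refine Submodule.subset_span ⟨Sum.inl ⟨a, by omega⟩, ?_⟩
        simp [m, show n + 1 - a = b by omega]
      · intro a b h
        refine Submodule.subset_span ⟨Sum.inr ⟨a, by omega⟩, ?_⟩
        simp [m, show n - a = b by omega]
      · rw [hdeg, ← Fin.sum_univ_three (fun i => d i)]
        exact (Finset.sum_subset (Finset.subset_univ _) (by simp)).symm
  have : FiniteDimensional ℝ W := FiniteDimensional.span_of_finite ℝ (Set.finite_range m)
  have hW : Module.finrank ℝ W ≤ 2 * n + 3 := by
    refine (finrank_range_le_card m).trans ?_
    simp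
    omega
  have h1 := Submodule.finrank_add_inf_finrank_orthogonal (polSpace_mono n.le_succ)
  have h2 := Submodule.finrank_mono hle
  have h3 := Submodule.finrank_add_le_finrank_add_finrank (polSpace n) W
  change _ + Module.finrank ℝ (harmSpace n) = _ at h1
  simp only [Nat.succ_eq_add_one] at h1
  omega

theorem exists_res_eq_const_of_mem {n : ℕ} : ∀ {p : Pol}, p ∈ restrictTotalDegree (Fin 3) ℝ n →
    (∀ i, res (angD i p) = 0) → ∃ c : ℝ, res p = algebraMap ℝ _ c := by
  induction n with
  | zero =>
    intro p hp _
    rw [mem_restrictTotalDegree, Nat.le_zero, totalDegree_eq_zero_iff_eq_C] at hp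
    exact ⟨coeff 0 p, by rw [hp, ← MvPolynomial.algebraMap_eq, AlgHom.commutes]; simp⟩
  | succ n ih =>
    intro p hp h
    obtain ⟨r, hr, hpr⟩ := exists_res_lap_eq hp
    have hlap : res (lap p) = 0 := by
      rw [lap_apply, map_sum]
      exact Finset.sum_eq_zero fun i _ => res_angD_eq_zero i (h i)
    rw [hlap, zero_add] at hpr
    have hpos : (0 : ℝ) < ((n : ℝ) + 1) * (n + 2) := by positivity
    have hpr' : res p = res ((((n : ℝ) + 1) * (n + 2))⁻¹ • r) := by
      rw [map_smul, ← hpr, inv_smul_smul₀ hpos.ne']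
    obtain ⟨c, hc⟩ := ih (Submodule.smul_mem _ ((((n : ℝ) + 1) * (n + 2))⁻¹) hr) fun i => by
      rw [← res_angD_congr i hpr', h]
    exact ⟨c, hpr'.trans hc⟩

theorem exists_res_eq_const {p : Pol} (h : ∀ i, res (angD i p) = 0) :
    ∃ c : ℝ, res p = algebraMap ℝ _ c :=
  exists_res_eq_const_of_mem ((mem_restrictTotalDegree _ _ _).mpr le_rfl) h

/-- The number of spherical harmonics of degree `n + 1` in an orthonormal basis. -/
noncomputable abbrev harmDim (n : ℕ) : ℕ := Module.finrank ℝ (harmSpace n)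

theorem exists_harm (n : ℕ) (k : Fin (harmDim n)) :
    ∃ p : Pol, resL2 p = stdOrthonormalBasis ℝ (harmSpace n) k :=
  let ⟨p, _, h⟩ := (stdOrthonormalBasis ℝ (harmSpace n) k).2.2
  ⟨p, h⟩

/-- An orthonormal basis of the spherical harmonics of degree `n + 1`, as polynomials. -/
noncomputable def harm (n : ℕ) (k : Fin (harmDim n)) : Pol := (exists_harm n k).choose

theorem resL2_harm (n : ℕ) (k : Fin (harmDim n)) :
    resL2 (harm n k) = stdOrthonormalBasis ℝ (harmSpace n) k := (exists_harm n k).choose_spec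

theorem resL2_harm_mem (n : ℕ) (k : Fin (harmDim n)) : resL2 (harm n k) ∈ harmSpace n := by
  rw [resL2_harm]; exact Subtype.property _

theorem eq_sum_harm {n : ℕ} {f : Lp ℝ 2 dS} (hf : f ∈ harmSpace n) :
    f = ∑ k, inner ℝ (resL2 (harm n k)) f • resL2 (harm n k) := by
  have := congrArg Subtype.val ((stdOrthonormalBasis ℝ (harmSpace n)).sum_repr' ⟨f, hf⟩)
  simp only [Submodule.coe_sum, Submodule.coe_smul, Submodule.coe_inner, ← resL2_harm] at this
  exact this.symm

theorem orthonormal_harm :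
    Orthonormal ℝ fun x : Σ n, Fin (harmDim n) => resL2 (harm x.1 x.2) := by
  constructor
  · rintro ⟨n, k⟩
    simp only [resL2_harm]
    exact (stdOrthonormalBasis ℝ (harmSpace n)).orthonormal.1 k
  · have hlt : ∀ {n n' : ℕ} (k : Fin (harmDim n)) (k' : Fin (harmDim n')), n < n' →
        inner ℝ (resL2 (harm n k)) (resL2 (harm n' k')) = 0 := fun k k' h =>
      (Submodule.mem_orthogonal _ _).mp (resL2_harm_mem _ k').1 _
        (polSpace_mono h (resL2_harm_mem _ k).2)
    rintro ⟨n, k⟩ ⟨n', k'⟩ hne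
    rcases lt_trichotomy n n' with h | rfl | h
    · exact hlt k k' h
    · have : k ≠ k' := fun h => hne (by rw [h])
      simp only [resL2_harm]
      rw [← Submodule.coe_inner]
      exact (stdOrthonormalBasis ℝ (harmSpace n)).orthonormal.2 this
    · rw [real_inner_comm]
      exact hlt k' k h

theorem inner_resL2_harm (x y : Σ n, Fin (harmDim n)) :
    inner ℝ (resL2 (harm x.1 x.2)) (resL2 (harm y.1 y.2)) = if x = y then 1 else 0 :=
  orthonormal_iff_ite.mp orthonormal_harm x y

/-- The squares of an orthonormal basis of spherical harmonics of a given degree have constant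
sum: the angular derivatives act on the basis by antisymmetric matrices. -/
theorem res_angD_sum_harm_sq (n : ℕ) (i : Fin 3) :
    res (angD i (∑ k, harm n k * harm n k)) = 0 := by
  have hexp : ∀ k, res (angD i (harm n k))
      = ∑ l, inner ℝ (resL2 (harm n l)) (resL2 (angD i (harm n k))) • res (harm n l) := fun k => by
    have h := eq_sum_harm (angD_mem_harmSpace i (resL2_harm_mem n k))
    simp only [← map_smul, ← map_sum] at h
    rw [resL2_eq_iff] at h
    simpa using h
  set a : Fin (harmDim n) → Fin (harmDim n) → ℝ := fun k l =>
    inner ℝ (resL2 (harm n l)) (resL2 (angD i (harm n k))) with ha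
  have hanti : ∀ k l, a k l = -a l k := fun k l => by
    simp only [ha]
    rw [real_inner_comm, inner_resL2_angD]
  have h1 : res (angD i (∑ k, harm n k * harm n k))
      = 2 * ∑ k, ∑ l, a k l • (res (harm n l) * res (harm n k)) := by
    simp only [map_sum, Derivation.leibniz, smul_eq_mul, map_add, map_mul, hexp, Finset.mul_sum]
    refine Finset.sum_congr rfl fun k _ => ?_
    rw [← Finset.sum_add_distrib]
    refine Finset.sum_congr rfl fun l _ => ?_
    simp only [Algebra.smul_def]
    ring
  have h2 : ∑ k, ∑ l, a k l • (res (harm n l) * res (harm n k))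
      = -∑ k, ∑ l, a k l • (res (harm n l) * res (harm n k)) := by
    conv_lhs => rw [Finset.sum_comm]
    simp only [← Finset.sum_neg_distrib]
    refine Finset.sum_congr rfl fun k _ => Finset.sum_congr rfl fun l _ => ?_
    rw [hanti l k, neg_smul, mul_comm]
  have h3 : (2 : ℝ) • ∑ k, ∑ l, a k l • (res (harm n l) * res (harm n k)) = 0 := by
    rw [two_smul]
    nth_rewrite 1 [h2]
    exact neg_add_cancel _
  rw [h1, (smul_eq_zero.mp h3).resolve_left two_ne_zero, mul_zero]

/-- The addition theorem for the gradients of spherical harmonics, obtained by applying `lap` to the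
constant sum of the squares of the harmonics. -/
theorem sum_sq_angD_harm (n : ℕ) (s : S2) :
    ∑ k, ∑ i, res (angD i (harm n k)) s ^ 2
      = ((n : ℝ) + 1) * (n + 2) * (harmDim n / (4 * Real.pi)) := by
  obtain ⟨c, hc⟩ := exists_res_eq_const (res_angD_sum_harm_sq n)
  have hcs : ∀ s, ∑ k, res (harm n k) s * res (harm n k) s = c := fun s => by
    have := DFunLike.congr_fun hc s
    simpa using this
  have hcd : c * (4 * Real.pi) = harmDim n := by
    have h1 : ∫ s, res (∑ k, harm n k * harm n k) s ∂dS = harmDim n := by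
      rw [integral_res_sum, Finset.sum_congr rfl fun k _ => by
        rw [← inner_resL2, inner_resL2_harm ⟨n, k⟩ ⟨n, k⟩, if_pos rfl]]
      simp
    rw [← h1, hc]
    simp [dS_real_univ, mul_comm]
  have hlap : res (lap (∑ k, harm n k * harm n k)) = 0 := by
    rw [lap_apply, map_sum]
    exact Finset.sum_eq_zero fun i _ => res_angD_eq_zero i (res_angD_sum_harm_sq n i)
  have h2 := DFunLike.congr_fun hlap s
  simp only [map_sum, lap_sq, map_mul, map_add,
    fun k => res_lap_of_mem_harmSpace (resL2_harm_mem n k)] at h2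
  simp only [map_ofNat, ContinuousMap.coe_sum, Finset.sum_apply, ContinuousMap.mul_apply,
    ContinuousMap.add_apply, ContinuousMap.smul_apply, ContinuousMap.zero_apply, smul_eq_mul,
    ← Finset.mul_sum, Finset.sum_add_distrib] at h2
  have h3 : ∑ k, res (harm n k) s * (-(((n : ℝ) + 1) * (n + 2)) * res (harm n k) s)
      = -(((n : ℝ) + 1) * (n + 2)) * c := by
    rw [← hcs s, Finset.mul_sum]
    exact Finset.sum_congr rfl fun k _ => by ring
  rw [h3] at h2
  simp only [sq]
  have hpi := Real.pi_pos
  have h4 : c = harmDim n / (4 * Real.pi) := by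
    rw [eq_div_iff (by positivity), hcd]
  rw [← h4]
  have h5 : (2 : C(S2, ℝ)) s = 2 := rfl
  rw [h5] at h2
  linarith

/-- A linear property of polynomials holds for all of them as soon as it holds for constants, for
polynomials vanishing on the sphere, and for the spherical harmonics. -/
theorem mem_of_harm_mem (P : Submodule ℝ Pol) (hC : ∀ c, C c ∈ P) (h0 : ∀ p, res p = 0 → p ∈ P)
    (hh : ∀ n k, harm n k ∈ P) (p : Pol) : p ∈ P := by
  suffices ∀ n, ∀ p ∈ restrictTotalDegree (Fin 3) ℝ n, p ∈ P from
    this p.totalDegree p ((mem_restrictTotalDegree _ _ _).mpr le_rfl)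
  intro n
  induction n with
  | zero =>
    intro p hp
    rw [mem_restrictTotalDegree, Nat.le_zero, totalDegree_eq_zero_iff_eq_C] at hp
    rw [hp]
    exact hC _
  | succ n ih =>
    intro p hp
    have hmem : resL2 p ∈ polSpace n ⊔ harmSpace n := by
      rw [harmSpace, Submodule.sup_orthogonal_inf_of_hasOrthogonalProjection
        (polSpace_mono n.le_succ)]
      exact ⟨p, hp, rfl⟩
    obtain ⟨_, ⟨q, hq, rfl⟩, f, hf, hqf⟩ := Submodule.mem_sup.mp hmem
    rw [eq_sum_harm hf] at hqf
    set a := fun k => inner ℝ (resL2 (harm n k)) f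
    have hp' : p = q + (∑ k, a k • harm n k) + (p - q - ∑ k, a k • harm n k) := by ring
    rw [hp']
    refine Submodule.add_mem _ (Submodule.add_mem _ (ih q hq)
      (Submodule.sum_mem _ fun k _ => Submodule.smul_mem _ _ (hh n k))) (h0 _ ?_)
    rw [← resL2_eq_zero_iff, map_sub, map_sub, ← hqf]
    simp [a]

/-- Polynomials are dense in `L²(𝕊²)`. -/
theorem eq_zero_of_inner_resL2 {f : Lp ℝ 2 dS} (h : ∀ p, inner ℝ f (resL2 p) = 0) : f = 0 := by
  have hsep : (res.range).SeparatesPoints := by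
    intro x y hxy
    by_contra! hcon
    refine hxy (Subtype.ext (PiLp.ext fun i => ?_))
    simpa using hcon (res (X i)) ⟨_, ⟨X i, rfl⟩, rfl⟩
  have hd : DenseRange (fun p : Pol => res p) := by
    have h1 := ContinuousMap.subalgebra_topologicalClosure_eq_top_of_separatesPoints _ hsep
    have h2 : closure (Set.range fun p : Pol => res p) = Set.univ := by
      have := congrArg (fun A : Subalgebra ℝ C(S2, ℝ) => (A : Set C(S2, ℝ))) h1
      simpa using this
    exact dense_iff_closure_eq.mpr h2
  have hd2 : DenseRange (fun p : Pol => resL2 p) :=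
    (ContinuousMap.toLp_denseRange ℝ dS ℝ (by norm_num)).comp hd
      (ContinuousMap.toLp 2 dS ℝ : C(S2, ℝ) →L[ℝ] Lp ℝ 2 dS).continuous
  have : (fun g : Lp ℝ 2 dS => (inner ℝ f g : ℝ)) = fun _ => 0 :=
    hd2.equalizer (by fun_prop) (by fun_prop) (funext h)
  exact inner_self_eq_zero.mp (congrFun this f)

/-- A weakly harmonic function on the sphere is constant. -/
theorem eq_const_of_inner_lap {f : Lp ℝ 2 dS} (h : ∀ p, inner ℝ f (resL2 (lap p)) = 0) :
    ∃ c : ℝ, f = resL2 (C c) := by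
  set c : ℝ := (4 * Real.pi)⁻¹ * inner ℝ f (resL2 1)
  refine ⟨c, ?_⟩
  rw [← sub_eq_zero]
  have hC : ∀ a : ℝ, (C a : Pol) = a • 1 := fun a => by rw [smul_eq_C_mul, mul_one]
  have h1 : inner ℝ (f - resL2 (C c)) (resL2 1) = 0 := by
    have hpi := Real.pi_pos
    rw [inner_sub_left, hC, map_smul, real_inner_smul_left, inner_resL2]
    simp [dS_real_univ, c]
    field_simp
    ring
  have h2 : ∀ p, inner ℝ (f - resL2 (C c)) (resL2 (lap p)) = 0 := fun p => by
    rw [inner_sub_left, h, hC, map_smul, real_inner_smul_left, inner_resL2, one_mul, lap_apply,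
      integral_res_sum]
    simp [integral_res_angD]
  refine eq_zero_of_inner_resL2 fun p => ?_
  suffices ∀ n, ∀ p ∈ restrictTotalDegree (Fin 3) ℝ n,
      inner ℝ (f - resL2 (C c)) (resL2 p) = 0 from
    this p.totalDegree p ((mem_restrictTotalDegree _ _ _).mpr le_rfl)
  intro n
  induction n with
  | zero =>
    intro p hp
    rw [mem_restrictTotalDegree, Nat.le_zero, totalDegree_eq_zero_iff_eq_C] at hp
    rw [hp, hC (coeff 0 p), map_smul, real_inner_smul_right, h1, mul_zero]
  | succ n ih =>
    intro p hp
    obtain ⟨r, hr, hpr⟩ := exists_res_lap_eq hp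
    have hpos : (0 : ℝ) < ((n : ℝ) + 1) * (n + 2) := by positivity
    have h3 : resL2 (lap p + (((n : ℝ) + 1) * (n + 2)) • p) = resL2 r := by
      rw [resL2_eq_iff, ← hpr]; simp
    have h4 := ih r hr
    rw [← h3, map_add, map_smul, inner_add_right, real_inner_smul_right, h2, zero_add] at h4
    exact (mul_eq_zero.mp h4).resolve_left hpos.ne'

/-! ### Vector spherical harmonics -/

/-- The vector field on the sphere with the given polynomial components. -/
noncomputable def polField (q : Fin 3 → Pol) : C(S2, E3) where
  toFun s := WithLp.toLp 2 fun i => res (q i) s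
  continuous_toFun := by fun_prop

@[simp]
theorem polField_apply (q : Fin 3 → Pol) (s : S2) (i : Fin 3) : polField q s i = res (q i) s := rfl

/-- `L²` class of a continuous vector field on the sphere. -/
noncomputable abbrev fieldL2 : C(S2, E3) →L[ℝ] Lp E3 2 dS := ContinuousMap.toLp 2 dS ℝ

theorem inner_fieldL2 (u : Lp E3 2 dS) (f : C(S2, E3)) :
    inner ℝ (fieldL2 f) u = ∫ s, inner ℝ (f s) (u s) ∂dS := by
  rw [L2.inner_def]
  refine integral_congr_ae ?_
  filter_upwards [ContinuousMap.coeFn_toLp (p := 2) (𝕜 := ℝ) dS f] with s hs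
  rw [hs]

theorem inner_fieldL2_fieldL2 (f g : C(S2, E3)) :
    inner ℝ (fieldL2 f) (fieldL2 g) = ∫ s, inner ℝ (f s) (g s) ∂dS := by
  rw [inner_fieldL2]
  refine integral_congr_ae ?_
  filter_upwards [ContinuousMap.coeFn_toLp (p := 2) (𝕜 := ℝ) dS g] with s hs
  rw [hs]

theorem inner_polField (q r : Fin 3 → Pol) (s : S2) :
    inner ℝ (polField q s) (polField r s) = res (∑ i, q i * r i) s := by
  simp [PiLp.inner_apply, mul_comm]

/-- The two differential operators from functions to tangent fields: `x × ∇` for `false`, whose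
values are divergence free, and `x × (x × ∇)` for `true`, whose values are gradients. -/
noncomputable def tangentOp (b : Bool) (p : Pol) (i : Fin 3) : Pol :=
  bif b then negGrad i p else angD i p

theorem tangentOp_add (b : Bool) (p q : Pol) (i : Fin 3) :
    tangentOp b (p + q) i = tangentOp b p i + tangentOp b q i := by
  cases b <;> simp [tangentOp, negGrad]
  ring

theorem tangentOp_smul (b : Bool) (c : ℝ) (p : Pol) (i : Fin 3) :
    tangentOp b (c • p) i = c • tangentOp b p i := by
  cases b <;> simp [tangentOp, negGrad, smul_sub]

/-- `tangentOp` with values in the continuous fields on the sphere. -/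
noncomputable def tangentField (b : Bool) : Pol →ₗ[ℝ] C(S2, E3) where
  toFun p := polField (tangentOp b p)
  map_add' p q := by ext s i; simp [tangentOp_add]
  map_smul' c p := by ext s i; simp [tangentOp_smul]

theorem tangentField_apply (b : Bool) (p : Pol) : tangentField b p = polField (tangentOp b p) := rfl

theorem tangentField_eq_zero (b : Bool) {p : Pol} (h : res p = 0) : tangentField b p = 0 := by
  ext s i
  cases b <;> simp [tangentField_apply, tangentOp, negGrad, res_angD_eq_zero _ h]

theorem tangentField_C (b : Bool) (c : ℝ) : tangentField b (C c) = 0 := by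
  have h (i : Fin 3) : angD i (C c) = 0 := (angD i).map_algebraMap c
  ext s i
  cases b <;> simp [tangentField_apply, tangentOp, negGrad, h]

theorem norm_sq_tangentField (b : Bool) (p : Pol) (s : S2) :
    ‖tangentField b p s‖ ^ 2 = ∑ i, res (angD i p) s ^ 2 := by
  rw [← real_inner_self_eq_norm_sq, tangentField_apply, inner_polField]
  cases b
  · simp [tangentOp, sq]
  · simp only [tangentOp, cond_true, sum_negGrad_mul_negGrad]
    simp [sq]

theorem integral_inner_tangentField (b b' : Bool) (p q : Pol) :
    ∫ s, inner ℝ (tangentField b p s) (tangentField b' q s) ∂dS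
      = if b = b' then -∫ s, res (p * lap q) s ∂dS else 0 := by
  simp only [tangentField_apply, inner_polField]
  have hmix (p q : Pol) : ∫ s, res (∑ i, angD i p * negGrad i q) s ∂dS = 0 := by
    rw [integral_res_sum, Finset.sum_congr rfl fun i _ => integral_res_angD_mul i p (negGrad i q),
      Finset.sum_neg_distrib, ← integral_res_sum, ← Finset.mul_sum, sum_angD_negGrad]
    simp
  cases b <;> cases b' <;> simp only [tangentOp, cond_true, cond_false, if_true, reduceCtorEq,
    if_false]
  · exact integral_res_sum_angD_mul_angD p q
  · exact hmix p q
  · simp only [mul_comm (negGrad _ p)]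
    exact hmix q p
  · rw [sum_negGrad_mul_negGrad, map_mul, res_normSqPol, one_mul]
    exact integral_res_sum_angD_mul_angD p q

/-- The polynomial normal fields on the sphere. -/
noncomputable def normalField (p : Pol) : C(S2, E3) := polField fun i => X i * p

theorem normalField_apply (p : Pol) (s : S2) : normalField p s = res p s • (s : E3) := by
  ext i
  simp [normalField, mul_comm]

theorem inner_tangentField_normalField (b : Bool) (p q : Pol) (s : S2) :
    inner ℝ (tangentField b p s) (normalField q s) = 0 := by
  rw [tangentField_apply, normalField, inner_polField]
  have h : ∑ i, X i * tangentOp b p i = 0 := by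
    cases b
    · exact sum_X_mul_angD p
    · exact sum_X_mul_negGrad p
  have h2 : ∑ i, tangentOp b p i * (X i * q) = (∑ i, X i * tangentOp b p i) * q := by
    rw [Finset.sum_mul]
    exact Finset.sum_congr rfl fun i _ => by ring
  rw [h2, h, zero_mul, map_zero, ContinuousMap.zero_apply]

/-- The tangent fields in `L²`, as the orthogonal complement of the polynomial normal fields. -/
noncomputable def tangentL2 : Submodule ℝ (Lp E3 2 dS) :=
  (Submodule.span ℝ (Set.range fun p => fieldL2 (normalField p)))ᗮ

theorem mem_tangentL2_iff {u : Lp E3 2 dS} :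
    u ∈ tangentL2 ↔ ∀ p, inner ℝ (fieldL2 (normalField p)) u = 0 := by
  rw [tangentL2, Submodule.mem_orthogonal]
  refine ⟨fun h p => h _ (Submodule.subset_span ⟨p, rfl⟩), fun h v hv => ?_⟩
  induction hv using Submodule.span_induction with
  | mem x hx => obtain ⟨p, rfl⟩ := hx; exact h p
  | zero => exact inner_zero_left _
  | add x y _ _ hx hy => rw [inner_add_left, hx, hy, add_zero]
  | smul c x _ hx => rw [real_inner_smul_left, hx, mul_zero]

theorem tangentField_mem_tangentL2 (b : Bool) (p : Pol) :
    fieldL2 (tangentField b p) ∈ tangentL2 := by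
  rw [mem_tangentL2_iff]
  intro q
  rw [real_inner_comm, inner_fieldL2_fieldL2]
  simp [inner_tangentField_normalField]

/-- The constant field `eⱼ` times `lap p`, split into a divergence-free field, a gradient and a
normal field. -/
theorem polField_single_lap (j : Fin 3) (p : Pol) :
    polField (fun i => if i = j then lap p else 0)
      = tangentField false (angD j p) + tangentField true (negGrad j p)
        + normalField (X j * lap p) := by
  ext s i
  have h := DFunLike.congr_fun (congrArg res (lap_smul_decomposition i j p)) s
  simp only [map_mul, map_sub, map_add, res_normSqPol, one_mul] at h
  by_cases hij : i = j
  · simp only [hij, if_true, res_normSqPol] at h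
    simp [tangentField_apply, normalField, tangentOp, hij] at h ⊢
    linarith
  · simp only [hij, if_false, map_zero] at h
    simp [tangentField_apply, normalField, tangentOp, hij] at h ⊢
    linarith

/-- The Helmholtz decomposition: a tangent field that is orthogonal to all fields `(x × ∇) p` and
`x × (x × ∇) p` vanishes, because its cartesian components are weakly harmonic, thus constant. -/
theorem eq_zero_of_inner_tangentField {u : Lp E3 2 dS} (hu : u ∈ tangentL2)
    (h : ∀ b p, inner ℝ (fieldL2 (tangentField b p)) u = 0) : u = 0 := by
  rw [mem_tangentL2_iff] at hu
  let comp (j : Fin 3) : Lp ℝ 2 dS := (EuclideanSpace.proj j : E3 →L[ℝ] ℝ).compLp u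
  have hcomp (j : Fin 3) : comp j =ᵐ[dS] fun s => u s j :=
    (EuclideanSpace.proj j : E3 →L[ℝ] ℝ).coeFn_compLp u
  have hinner (j : Fin 3) (p : Pol) : inner ℝ (comp j) (resL2 p)
      = inner ℝ (fieldL2 (polField fun i => if i = j then p else 0)) u := by
    rw [inner_fieldL2, L2.inner_def]
    refine integral_congr_ae ?_
    filter_upwards [hcomp j, coeFn_resL2 p] with s h1 h2
    rw [h1, h2]
    simp [PiLp.inner_apply, apply_ite, apply_ite (fun f : C(S2, ℝ) => f s), mul_comm]
  have hconst (j : Fin 3) : ∃ c : ℝ, comp j = resL2 (C c) :=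
    eq_const_of_inner_lap fun p => by
      rw [hinner, polField_single_lap, map_add, map_add, inner_add_left, inner_add_left, h, h, hu,
        add_zero, add_zero]
  choose c hc using hconst
  have hcs : ∀ᵐ s ∂dS, ∀ j, u s j = c j := by
    rw [ae_all_iff]
    intro j
    have h1 := hcomp j
    rw [hc j] at h1
    filter_upwards [h1, coeFn_resL2 (C (c j))] with s h2 h3
    rw [← h2, h3]
    simp
  have hnull : resL2 (∑ j, C (c j) * X j) = 0 := by
    rw [← inner_self_eq_zero (𝕜 := ℝ), inner_resL2, ← hu (∑ j, C (c j) * X j), inner_fieldL2]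
    refine integral_congr_ae ?_
    filter_upwards [hcs] with s hs
    simp only [normalField_apply, PiLp.inner_apply, hs]
    simp only [map_mul, map_sum, ContinuousMap.mul_apply, ContinuousMap.coe_sum, Finset.sum_apply,
      PiLp.smul_apply, smul_eq_mul, res_X, res_apply (C _), eval_C, RCLike.inner_apply,
      conj_trivial]
    rw [Finset.sum_mul]
    exact Finset.sum_congr rfl fun i _ => by ring
  rw [resL2_eq_zero_iff] at hnull
  have hc0 (j : Fin 3) : c j = 0 := by
    have := DFunLike.congr_fun hnull ⟨EuclideanSpace.single j 1, by simp⟩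
    simpa [res_apply] using this
  rw [Lp.eq_zero_iff_ae_eq_zero]
  filter_upwards [hcs] with s hs
  ext j
  simp [hs, hc0]

/-- The eigenvalue `(n + 1) (n + 2)` of the spherical harmonics of degree `n + 1`. -/
noncomputable def eig (n : ℕ) : ℝ := ((n : ℝ) + 1) * (n + 2)

theorem eig_pos (n : ℕ) : 0 < eig n := by unfold eig; positivity

/-- Index of the vector spherical harmonics: the kind of the field, the degree (less one), and the
number of the scalar harmonic. -/
abbrev HarmIdx : Type := Bool × Σ n, Fin (harmDim n)

/-- The vector spherical harmonics `(x × ∇) Y / √λ` and `x × (x × ∇) Y / √λ`. -/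
noncomputable def vecHarm (k : HarmIdx) : C(S2, E3) :=
  (√(eig k.2.1))⁻¹ • tangentField k.1 (harm k.2.1 k.2.2)

theorem integral_inner_vecHarm (k l : HarmIdx) :
    ∫ s, inner ℝ (vecHarm k s) (vecHarm l s) ∂dS = if k = l then 1 else 0 := by
  obtain ⟨b, n, i⟩ := k
  obtain ⟨b', n', i'⟩ := l
  simp only [vecHarm, ContinuousMap.smul_apply, real_inner_smul_left, real_inner_smul_right]
  rw [integral_const_mul, integral_const_mul, integral_inner_tangentField]
  have h1 : res (lap (harm n' i')) = res (-eig n' • harm n' i') := by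
    rw [res_lap_of_mem_harmSpace (resL2_harm_mem _ _), map_smul, eig]
  have h2 : ∫ s, res (harm n i * lap (harm n' i')) s ∂dS
      = -eig n' * if (⟨n, i⟩ : Σ n, Fin (harmDim n)) = ⟨n', i'⟩ then 1 else 0 := by
    rw [map_mul, h1, ← map_mul, ← inner_resL2, map_smul, real_inner_smul_right,
      inner_resL2_harm ⟨n, i⟩ ⟨n', i'⟩]
  rw [h2]
  by_cases hb : b = b'
  · by_cases hx : (⟨n, i⟩ : Σ n, Fin (harmDim n)) = ⟨n', i'⟩
    · obtain rfl : n = n' := congrArg Sigma.fst hx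
      have := eig_pos n
      have hs := Real.mul_self_sqrt this.le
      have hs0 : √(eig n) ≠ 0 := (Real.sqrt_pos.mpr this).ne'
      rw [if_pos hb, if_pos hx, if_pos (by rw [hb, hx])]
      field_simp
      rw [sq, hs]
    · rw [if_pos hb, if_neg hx, if_neg fun h => hx (Prod.ext_iff.mp h).2]
      ring
  · rw [if_neg hb, if_neg fun h => hb (Prod.ext_iff.mp h).1]
    ring

theorem orthonormal_vecHarm : Orthonormal ℝ fun k => fieldL2 (vecHarm k) := by
  rw [orthonormal_iff_ite]
  intro k l
  rw [inner_fieldL2_fieldL2, integral_inner_vecHarm]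

theorem vecHarm_mem_tangentL2 (k : HarmIdx) : fieldL2 (vecHarm k) ∈ tangentL2 := by
  rw [vecHarm, map_smul]
  exact Submodule.smul_mem _ _ (tangentField_mem_tangentL2 _ _)

theorem eq_zero_of_inner_vecHarm {u : Lp E3 2 dS} (hu : u ∈ tangentL2)
    (h : ∀ k, inner ℝ (fieldL2 (vecHarm k)) u = 0) : u = 0 := by
  refine eq_zero_of_inner_tangentField hu fun b p => ?_
  let P : Submodule ℝ Pol := LinearMap.ker
    ((innerₛₗ ℝ u).comp (fieldL2.toLinearMap ∘ₗ tangentField b))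
  have hP (p : Pol) : p ∈ P ↔ inner ℝ (fieldL2 (tangentField b p)) u = 0 := by
    rw [real_inner_comm]; exact LinearMap.mem_ker
  rw [← hP]
  refine mem_of_harm_mem P (fun c => ?_) (fun p hp => ?_) (fun n k => ?_) p
  · rw [hP, tangentField_C, map_zero, inner_zero_left]
  · rw [hP, tangentField_eq_zero b hp, map_zero, inner_zero_left]
  · have h1 := h (b, ⟨n, k⟩)
    rw [vecHarm, map_smul, real_inner_smul_left] at h1
    exact (hP _).mpr ((mul_eq_zero.mp h1).resolve_left
      (inv_ne_zero (Real.sqrt_pos.mpr (eig_pos n)).ne'))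

/-- The indices of the vector spherical harmonics of the kinds in `B` and of degree at most `M`; the
degree being `n + 1`, this means `n < M`. -/
noncomputable def harmIdxLE (B : Finset Bool) (M : ℕ) : Finset HarmIdx :=
  B ×ˢ (Finset.range M).sigma fun _ => Finset.univ

theorem tendsto_sum_vecHarm {u : Lp E3 2 dS} (hu : u ∈ tangentL2) :
    Tendsto (fun M => ∑ k ∈ harmIdxLE Finset.univ M,
      inner ℝ (fieldL2 (vecHarm k)) u • fieldL2 (vecHarm k)) atTop (𝓝 u) := by
  have : CompleteSpace tangentL2 := by unfold tangentL2; infer_instance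
  let e : HarmIdx → tangentL2 := fun k => ⟨fieldL2 (vecHarm k), vecHarm_mem_tangentL2 k⟩
  have he : Orthonormal ℝ e := by
    have := orthonormal_vecHarm
    rw [orthonormal_iff_ite] at this ⊢
    exact this
  have hbot : (Submodule.span ℝ (Set.range e))ᗮ = ⊥ := by
    rw [Submodule.eq_bot_iff]
    intro v hv
    rw [Submodule.mem_orthogonal] at hv
    exact Subtype.ext (eq_zero_of_inner_vecHarm v.2 fun k =>
      hv (e k) (Submodule.subset_span ⟨k, rfl⟩))
  let b := HilbertBasis.mkOfOrthogonalEqBot he hbot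
  have hb (k) : b k = e k := by
    rw [HilbertBasis.coe_mkOfOrthogonalEqBot]
  have h := (b.hasSum_repr ⟨u, hu⟩).mapL tangentL2.subtypeL
  have hmono : Monotone (harmIdxLE Finset.univ) := fun M M' hM k => by
    simp only [harmIdxLE, Finset.mem_product, Finset.mem_sigma, Finset.mem_range, Finset.mem_univ,
      and_true, true_and]
    exact fun h => h.trans_le hM
  have hT : Tendsto (harmIdxLE Finset.univ) atTop atTop :=
    tendsto_atTop_finset_of_monotone hmono fun k => ⟨k.2.1 + 1, by simp [harmIdxLE]⟩
  refine (h.comp hT).congr fun M => Finset.sum_congr rfl fun k _ => ?_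
  have h1 : b.repr ⟨u, hu⟩ k = inner ℝ (fieldL2 (vecHarm k)) u := by
    rw [b.repr_apply_apply, hb]
    rfl
  have h2 : (b k : Lp E3 2 dS) = fieldL2 (vecHarm k) := by rw [hb]
  change b.repr ⟨u, hu⟩ k • (b k : Lp E3 2 dS) = _
  rw [h1, h2]

/-- By the addition theorem the left side is constant on the sphere; it equals the number of
harmonics divided by `4 π`. -/
theorem sum_norm_sq_vecHarm (b : Bool) (n : ℕ) (s : S2) :
    ∑ i, ‖vecHarm (b, ⟨n, i⟩) s‖ ^ 2 ≤ (2 * n + 3) / (4 * Real.pi) := by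
  have hpi := Real.pi_pos
  have he := eig_pos n
  have h (i : Fin (harmDim n)) : ‖vecHarm (b, ⟨n, i⟩) s‖ ^ 2
      = (eig n)⁻¹ * ∑ j, res (angD j (harm n i)) s ^ 2 := by
    simp only [vecHarm, ContinuousMap.smul_apply, norm_smul, mul_pow, norm_sq_tangentField]
    rw [Real.norm_eq_abs, sq_abs, inv_pow, Real.sq_sqrt he.le]
  rw [Finset.sum_congr rfl fun i _ => h i, ← Finset.mul_sum, sum_sq_angD_harm]
  change (eig n)⁻¹ * (eig n * _) ≤ _
  rw [inv_mul_cancel_left₀ he.ne']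
  gcongr
  exact_mod_cast finrank_harmSpace_le n

/-! ### Weak divergence and rotation of fields with a weak covariant derivative -/

/-- The tangential projection `eᵢ - sᵢ s` of the `i`-th coordinate vector, extended to `ℝ³`. -/
noncomputable def coordField (i : Fin 3) (x : E3) : E3 := EuclideanSpace.single i 1 - x i • x

theorem contDiff_coordField (i : Fin 3) : ContDiff ℝ ∞ (coordField i) := by
  unfold coordField
  have : ContDiff ℝ ∞ fun x : E3 => x i := (EuclideanSpace.proj i : E3 →L[ℝ] ℝ).contDiff
  fun_prop

theorem coordField_apply (i k : Fin 3) (x : E3) :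
    coordField i x k = (if k = i then 1 else 0) - x i * x k := by
  simp [coordField]

theorem fderiv_coordField (i : Fin 3) (x : E3) :
    fderiv ℝ (coordField i) x = -(x i • ContinuousLinearMap.id ℝ E3
      + (EuclideanSpace.proj i : E3 →L[ℝ] ℝ).smulRight x) := by
  have h : HasFDerivAt (fun x : E3 => x i) (EuclideanSpace.proj i : E3 →L[ℝ] ℝ) x :=
    (EuclideanSpace.proj i : E3 →L[ℝ] ℝ).hasFDerivAt
  exact ((h.smul (hasFDerivAt_id x)).const_sub _).fderiv

theorem isSmoothTangent_coordField (i : Fin 3) : IsSmoothTangent (coordField i) := by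
  refine ⟨contDiff_coordField i, fun s => ?_⟩
  have h := sum_sq_sphere s
  simp only [Fin.sum_univ_three] at h
  simp only [PiLp.inner_apply, coordField_apply, Fin.sum_univ_three, RCLike.inner_apply,
    conj_trivial]
  fin_cases i <;> simp <;> [linear_combination (-(s : E3) 0) * h;
    linear_combination (-(s : E3) 1) * h; linear_combination (-(s : E3) 2) * h]

theorem surfDiv_coordField (i : Fin 3) (s : S2) :
    surfDiv (coordField i) s = -2 * (s : E3) i := by
  have hs : inner ℝ (s : E3) (s : E3) = 1 := by
    rw [real_inner_self_eq_norm_sq]; simp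
  have htr : LinearMap.trace ℝ E3 (fderiv ℝ (coordField i) (s : E3) : E3 →ₗ[ℝ] E3)
      = -4 * (s : E3) i := by
    have : (fderiv ℝ (coordField i) (s : E3) : E3 →ₗ[ℝ] E3) = -((s : E3) i • LinearMap.id
        + (EuclideanSpace.proj i : E3 →L[ℝ] ℝ).toLinearMap.smulRight (s : E3)) := by
      rw [fderiv_coordField]; rfl
    rw [this, map_neg, map_add, map_smul, LinearMap.trace_id, LinearMap.trace_smulRight]
    simp
    ring
  rw [surfDiv, htr, fderiv_coordField]
  simp [inner_add_left, real_inner_smul_left]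
  ring

/-- The linear map `x ↦ x × eᵢ`. -/
noncomputable def crossField (i : Fin 3) : E3 →L[ℝ] E3 :=
  LinearMap.toContinuousLinearMap
    { toFun := fun x => WithLp.toLp 2 (crossProduct (WithLp.ofLp x) (Pi.single i 1))
      map_add' := fun x y => by simp
      map_smul' := fun c x => by simp }

theorem crossField_apply (i : Fin 3) (x : E3) :
    crossField i x = WithLp.toLp 2 (crossProduct (WithLp.ofLp x) (Pi.single i 1)) := rfl

theorem isSmoothTangent_crossField (i : Fin 3) : IsSmoothTangent (crossField i) := by
  refine ⟨(crossField i).contDiff, fun s => ?_⟩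
  simp only [PiLp.inner_apply, crossField_apply, Fin.sum_univ_three, cross_apply]
  fin_cases i <;> simp <;> ring

theorem IsSmoothTangent.smul {φ : E3 → ℝ} {X : E3 → E3} (hX : IsSmoothTangent X)
    (hφ : ContDiff ℝ ∞ φ) : IsSmoothTangent fun x => φ x • X x :=
  ⟨hφ.smul hX.smooth, fun s => by rw [real_inner_smul_left, hX.tangent, mul_zero]⟩

theorem IsSmoothTangent.continuous_covDeriv {X Y : E3 → E3} (hX : IsSmoothTangent X)
    (hY : IsSmoothTangent Y) : Continuous (covDeriv X Y) := by
  unfold covDeriv tangentProj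
  have h1 := hX.smooth.continuous
  have h2 := hY.smooth.continuous_fderiv (by simp)
  fun_prop

theorem inner_tangentProj {s : S2} {v : E3} (hv : inner ℝ v (s : E3) = 0) (w : E3) :
    inner ℝ v (tangentProj s w) = inner ℝ v w := by
  rw [tangentProj, inner_sub_right, real_inner_smul_right, hv, mul_zero, sub_zero]

theorem inner_surfGrad {s : S2} {v : E3} (hv : inner ℝ v (s : E3) = 0) (φ : E3 → ℝ) :
    inner ℝ v (surfGrad φ s) = fderiv ℝ φ (s : E3) v := by
  rw [surfGrad, inner_tangentProj hv, inner_gradient_right, conj_trivial]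

theorem memLp_inner_apply {T : S2 → E3 →L[ℝ] E3} (hT : MemLp T 2 dS) (a b : C(S2, E3)) :
    MemLp (fun s => inner ℝ (T s (a s)) (b s)) 2 dS := by
  refine hT.of_le_mul (c := ‖a‖ * ‖b‖) ?_ (Filter.Eventually.of_forall fun s => ?_)
  · exact AEStronglyMeasurable.inner
      (isBoundedBilinearMap_apply.continuous.comp_aestronglyMeasurable
        (hT.1.prodMk a.continuous.aestronglyMeasurable))
      b.continuous.aestronglyMeasurable
  · calc ‖inner ℝ (T s (a s)) (b s)‖ ≤ ‖T s (a s)‖ * ‖b s‖ := norm_inner_le_norm _ _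
      _ ≤ ‖T s‖ * ‖a‖ * ‖b‖ := by
        gcongr
        · exact (T s).le_of_opNorm_le_of_le le_rfl (a.norm_coe_le_norm s)
        · exact b.norm_coe_le_norm s
      _ = ‖a‖ * ‖b‖ * ‖T s‖ := by ring

theorem integrable_inner_of_memLp {u : S2 → E3} (hu : MemLp u 2 dS) (b : C(S2, E3)) :
    Integrable (fun s => inner ℝ (u s) (b s)) dS :=
  (hu.of_le_mul (c := ‖b‖) (hu.1.inner b.continuous.aestronglyMeasurable)
    (Filter.Eventually.of_forall fun s => (norm_inner_le_norm _ _).trans (by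
      rw [mul_comm]
      gcongr
      exact b.norm_coe_le_norm s))).integrable one_le_two

/-- A weak divergence, obtained by testing the weak covariant derivative with the pairs
`(Xᵢ, φ Zᵢ)`, where `Xᵢ = coordField i`. The fields `Zᵢ = Xᵢ` lead to the divergence of `u`, and
`Zᵢ = s × eᵢ` to that of `u^⊥`. -/
theorem isWeakDiv_of_isWeakCovDeriv {u v : S2 → E3} {T : S2 → E3 →L[ℝ] E3} (hu : IsL2Field u)
    (hTL : MemLp T 2 dS) (hT : IsWeakCovDeriv u T) {Z : Fin 3 → E3 → E3}
    (hZ : ∀ i, IsSmoothTangent (Z i))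
    (hv : ∀ᵐ s ∂dS, inner ℝ (v s) (s : E3) = 0)
    (h1 : ∀ᵐ s : S2 ∂dS, ∑ i, inner ℝ (u s) (Z i s) • coordField i s = v s)
    (h2 : ∀ᵐ s : S2 ∂dS, ∑ i, inner ℝ (u s) (fderiv ℝ (Z i) (s : E3) (coordField i s)) = 0)
    (h3 : ∀ᵐ s : S2 ∂dS, ∑ i, (s : E3) i * inner ℝ (u s) (Z i s) = 0) :
    IsWeakDiv v fun s => ∑ i, inner ℝ (T s (coordField i s)) (Z i s) := by
  have hXc (i : Fin 3) : Continuous fun s : S2 => coordField i s :=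
    (contDiff_coordField i).continuous.comp continuous_subtype_val
  have hZc (i : Fin 3) : Continuous fun s : S2 => Z i s :=
    (hZ i).smooth.continuous.comp continuous_subtype_val
  refine ⟨memLp_finsetSum _ fun i _ => memLp_inner_apply hTL ⟨_, hXc i⟩ ⟨_, hZc i⟩, fun φ hφ => ?_⟩
  have hφc : Continuous fun s : S2 => φ s := hφ.continuous.comp continuous_subtype_val
  have hbp (i : Fin 3) := hT.byParts _ _ (isSmoothTangent_coordField i) ((hZ i).smul hφ)
  have hL : ∫ s : S2, (∑ i, inner ℝ (T s (coordField i s)) (Z i s)) * φ s ∂dS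
      = ∑ i, ∫ s : S2, inner ℝ (T s (coordField i s)) (φ s • Z i s) ∂dS := by
    have hint (i : Fin 3) :
        Integrable (fun s : S2 => inner ℝ (T s (coordField i s)) (φ s • Z i s)) dS :=
      (memLp_inner_apply hTL ⟨_, hXc i⟩ ⟨_, hφc.smul (hZc i)⟩).integrable one_le_two
    rw [← integral_finsetSum _ fun i _ => hint i]
    simp only [real_inner_smul_right, mul_comm _ (φ _), Finset.mul_sum]
  have hI (i : Fin 3) : Integrable (fun s : S2 =>
      inner ℝ (u s) (covDeriv (coordField i) (fun x => φ x • Z i x) s)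
        + inner ℝ (u s) (φ s • Z i s) * surfDiv (coordField i) s) dS := by
    refine (integrable_inner_of_memLp hu.memLp
      ⟨_, (isSmoothTangent_coordField i).continuous_covDeriv ((hZ i).smul hφ)⟩).add ?_
    have hc : Continuous fun s : S2 => (-2 * (s : E3) i) • φ s • Z i s := by
      have h1 := hφ.continuous
      have h2 := (hZ i).smooth.continuous
      fun_prop
    refine (integrable_inner_of_memLp hu.memLp ⟨_, hc⟩).congr
      (Filter.Eventually.of_forall fun s => ?_)
    simp only [ContinuousMap.coe_mk, surfDiv_coordField, real_inner_smul_right]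
    ring
  rw [hL, Finset.sum_congr rfl fun i _ => hbp i, Finset.sum_neg_distrib,
    ← integral_finsetSum _ fun i _ => hI i]
  congr 1
  refine integral_congr_ae ?_
  filter_upwards [hu.tangent, hv, h1, h2, h3] with s hus hvs h1 h2 h3
  have hfd (i : Fin 3) (w : E3) : fderiv ℝ (fun x => φ x • Z i x) (s : E3) w
      = φ s • fderiv ℝ (Z i) (s : E3) w + fderiv ℝ φ (s : E3) w • Z i s := by
    rw [fderiv_fun_smul (hφ.differentiable (by simp) _) ((hZ i).smooth.differentiable (by simp) _)]
    simp
  rw [inner_surfGrad hvs, ← h1, map_sum]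
  have hterm (i : Fin 3) : inner ℝ (u s) (covDeriv (coordField i) (fun x => φ x • Z i x) s)
        + inner ℝ (u s) (φ s • Z i s) * surfDiv (coordField i) s
      = fderiv ℝ φ (s : E3) (inner ℝ (u s) (Z i s) • coordField i s)
        + φ s * inner ℝ (u s) (fderiv ℝ (Z i) (s : E3) (coordField i s))
        + (-2 * φ s) * ((s : E3) i * inner ℝ (u s) (Z i s)) := by
    rw [covDeriv, inner_tangentProj hus, hfd, surfDiv_coordField, inner_add_right]
    simp only [real_inner_smul_right, map_smul, smul_eq_mul]
    ring
  rw [Finset.sum_congr rfl fun i _ => hterm i, Finset.sum_add_distrib, Finset.sum_add_distrib,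
    ← Finset.mul_sum, ← Finset.mul_sum, h2, h3, mul_zero, mul_zero, add_zero, add_zero]

theorem sum_mul_eq_zero_of_inner {s : S2} {v : E3} (hv : inner ℝ v (s : E3) = 0) :
    v 0 * (s : E3) 0 + v 1 * (s : E3) 1 + v 2 * (s : E3) 2 = 0 := by
  rw [PiLp.inner_apply, Fin.sum_univ_three] at hv
  simpa [mul_comm] using hv

theorem inner_perp (u : S2 → E3) (s : S2) : inner ℝ (perp u s) (s : E3) = 0 := by
  simp only [PiLp.inner_apply, perp, Fin.sum_univ_three, cross_apply]
  simp
  ring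

theorem inner_coordField {s : S2} {v : E3} (hv : inner ℝ v (s : E3) = 0) (i : Fin 3) :
    inner ℝ v (coordField i s) = v i := by
  rw [coordField, inner_sub_right, real_inner_smul_right, hv, mul_zero, sub_zero,
    EuclideanSpace.inner_single_right, one_mul, conj_trivial]

theorem inner_crossField (u : S2 → E3) (s : S2) (i : Fin 3) :
    inner ℝ (u s) (crossField i s) = perp u s i := by
  simp only [PiLp.inner_apply, perp, crossField_apply, Fin.sum_univ_three, cross_apply]
  fin_cases i <;> simp <;> ring

theorem sum_smul_coordField {s : S2} {v : E3} (hv : inner ℝ v (s : E3) = 0) :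
    ∑ i, v i • coordField i s = v := by
  have h := sum_mul_eq_zero_of_inner hv
  ext k
  simp only [Fin.sum_univ_three, PiLp.add_apply, PiLp.smul_apply, smul_eq_mul, coordField_apply]
  fin_cases k <;> simp <;> [linear_combination (-(s : E3) 0) * h;
    linear_combination (-(s : E3) 1) * h; linear_combination (-(s : E3) 2) * h]

theorem IsH1Field.exists_isWeakDiv {u : S2 → E3} (hu : IsH1Field u) : ∃ g, IsWeakDiv u g := by
  obtain ⟨hL, T, hTL, hT⟩ := hu
  refine ⟨_, isWeakDiv_of_isWeakCovDeriv hL hTL hT isSmoothTangent_coordField hL.tangent ?_ ?_ ?_⟩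
  · filter_upwards [hL.tangent] with s hs
    simp only [inner_coordField hs]
    exact sum_smul_coordField hs
  · filter_upwards [hL.tangent] with s hs
    have h := sum_mul_eq_zero_of_inner hs
    simp only [fderiv_coordField]
    simp [inner_add_right, real_inner_smul_right, hs, inner_coordField hs, Fin.sum_univ_three]
    linear_combination -h
  · filter_upwards [hL.tangent] with s hs
    have h := sum_mul_eq_zero_of_inner hs
    simp only [inner_coordField hs, Fin.sum_univ_three]
    linear_combination h

theorem IsH1Field.exists_isWeakDiv_perp {u : S2 → E3} (hu : IsH1Field u) :
    ∃ g, IsWeakDiv (perp u) g := by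
  obtain ⟨hL, T, hTL, hT⟩ := hu
  refine ⟨_, isWeakDiv_of_isWeakCovDeriv hL hTL hT isSmoothTangent_crossField
    (Filter.Eventually.of_forall (inner_perp u)) ?_ ?_ ?_⟩
  · refine Filter.Eventually.of_forall fun s => ?_
    simp only [inner_crossField]
    exact sum_smul_coordField (inner_perp u s)
  · refine Filter.Eventually.of_forall fun s => ?_
    have h := sum_mul_eq_zero_of_inner (inner_perp u s)
    have hcross (i : Fin 3) : crossField i (coordField i s) = -(s : E3) i • crossField i s := by
      rw [coordField, map_sub, map_smul, neg_smul, sub_eq_neg_self, crossField_apply]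
      simp
    simp only [ContinuousLinearMap.fderiv, hcross, real_inner_smul_right, inner_crossField,
      Fin.sum_univ_three]
    linear_combination -h
  · refine Filter.Eventually.of_forall fun s => ?_
    have h := sum_mul_eq_zero_of_inner (inner_perp u s)
    simp only [inner_crossField, Fin.sum_univ_three]
    linear_combination h

/-! ### Coefficients of a field in terms of its divergence and rotation -/

theorem hasFDerivAt_eval (p : Pol) (x : E3) :
    HasFDerivAt (fun x : E3 => eval (fun i => x i) p)
      (∑ i, eval (fun i => x i) (pderiv i p) • (EuclideanSpace.proj i : E3 →L[ℝ] ℝ)) x := by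
  induction p using MvPolynomial.induction_on with
  | C a => simpa using hasFDerivAt_const a x
  | add p q hp hq =>
    simpa [add_smul, Finset.sum_add_distrib] using hp.fun_add hq
  | mul_X p k hp =>
    have h : HasFDerivAt (fun x : E3 => x k) (EuclideanSpace.proj k : E3 →L[ℝ] ℝ) x :=
      (EuclideanSpace.proj k : E3 →L[ℝ] ℝ).hasFDerivAt
    have h2 := hp.fun_mul h
    simp only [map_mul, eval_X]
    refine h2.congr_fderiv ?_
    ext w
    simp [pderiv_X, Pi.single_apply, Finset.mul_sum, apply_ite, mul_comm]
    simp only [mul_add, Finset.sum_add_distrib, mul_ite, mul_zero, Finset.sum_ite_eq,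
      Finset.mem_univ, if_true]
    congr 1
    exact Finset.sum_congr rfl fun i _ => by ring

theorem contDiff_eval (p : Pol) : ContDiff ℝ ∞ fun x : E3 => eval (fun i => x i) p := by
  induction p using MvPolynomial.induction_on with
  | C a => simpa using contDiff_const
  | add p q hp hq => simpa using hp.add hq
  | mul_X p k hp =>
    simpa using hp.mul (EuclideanSpace.proj k : E3 →L[ℝ] ℝ).contDiff

theorem inner_surfGrad_eval {s : S2} {v : E3} (hv : inner ℝ v (s : E3) = 0) (p : Pol) :
    inner ℝ v (surfGrad (fun x : E3 => eval (fun i => x i) p) s)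
      = ∑ i, res (pderiv i p) s * v i := by
  rw [inner_surfGrad hv, (hasFDerivAt_eval p s).fderiv]
  simp [res_apply]

theorem IsWeakDiv.integral_inner_tangentField_true {u : S2 → E3} {g : S2 → ℝ}
    (hu : ∀ᵐ s ∂dS, inner ℝ (u s) (s : E3) = 0) (hg : IsWeakDiv u g) (p : Pol) :
    ∫ s, inner ℝ (tangentField true p s) (u s) ∂dS = ∫ s, g s * res p s ∂dS := by
  have h := hg.byParts _ (contDiff_eval p)
  simp only [← res_apply] at h
  rw [h, ← integral_neg]
  refine integral_congr_ae ?_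
  filter_upwards [hu] with s hs
  have h1 := sum_sq_sphere s
  have h2 := sum_mul_eq_zero_of_inner hs
  rw [inner_surfGrad_eval hs]
  simp only [tangentField_apply, tangentOp, cond_true, PiLp.inner_apply, polField_apply, negGrad,
    Fin.sum_univ_three, angD_apply] at h1 ⊢
  simp
  linear_combination (-(u s 0 * res (pderiv 0 p) s + u s 1 * res (pderiv 1 p) s
    + u s 2 * res (pderiv 2 p) s)) * h1 + ((s : E3) 0 * res (pderiv 0 p) s
    + (s : E3) 1 * res (pderiv 1 p) s + (s : E3) 2 * res (pderiv 2 p) s) * h2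

theorem IsWeakDiv.integral_inner_tangentField_false {u : S2 → E3} {g : S2 → ℝ}
    (hg : IsWeakDiv (perp u) g) (p : Pol) :
    ∫ s, inner ℝ (tangentField false p s) (u s) ∂dS = -∫ s, g s * res p s ∂dS := by
  have h := hg.byParts _ (contDiff_eval p)
  simp only [← res_apply] at h
  rw [h, neg_neg]
  refine integral_congr_ae (Filter.Eventually.of_forall fun s => ?_)
  simp only [inner_surfGrad_eval (inner_perp u s)]
  simp only [tangentField_apply, tangentOp, cond_false, PiLp.inner_apply, polField_apply,
    Fin.sum_univ_three, angD_apply, perp, cross_apply]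
  simp
  ring

/-! ### The spectral cut-off and its one-dimensional integrals -/

/-- The function `a² / (y² + a²)`. With `a = 4 λ / π` and `y = E` it is the weight that the spectral
cut-off at the energy `E` puts on the eigenvalue `λ`; the complementary weight is the same function
with `a = π E / 4` and `y = λ`. -/
noncomputable def cutoff (a y : ℝ) : ℝ := a ^ 2 / (y ^ 2 + a ^ 2)

theorem continuous_cutoff {a : ℝ} (ha : 0 < a) : Continuous (cutoff a) := by
  unfold cutoff
  exact continuous_const.div (by fun_prop) fun y => by positivity

theorem one_sub_cutoff {l E : ℝ} (hl : 0 < l) :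
    1 - cutoff (4 * l / Real.pi) E = cutoff (Real.pi * E / 4) l := by
  have hpi := Real.pi_pos
  have h1 : E ^ 2 + (4 * l / Real.pi) ^ 2 ≠ 0 := by positivity
  have h2 : l ^ 2 + (Real.pi * E / 4) ^ 2 ≠ 0 := by positivity
  unfold cutoff
  rw [one_sub_div h1, div_eq_div_iff h1 h2]
  field_simp
  ring

/-- A primitive of `cutoff a ^ 2`. -/
noncomputable def cutoffPrim (a y : ℝ) : ℝ :=
  (a ^ 2 * y / (y ^ 2 + a ^ 2) + a * Real.arctan (y / a)) / 2

theorem hasDerivAt_cutoffPrim {a : ℝ} (ha : 0 < a) (y : ℝ) :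
    HasDerivAt (cutoffPrim a) (cutoff a y ^ 2) y := by
  have h0 : y ^ 2 + a ^ 2 ≠ 0 := by positivity
  have h1 : HasDerivAt (fun y : ℝ => a ^ 2 * y) (a ^ 2) y := by
    simpa using (hasDerivAt_id y).const_mul (a ^ 2)
  have h2 : HasDerivAt (fun y : ℝ => y ^ 2 + a ^ 2) (2 * y) y := by
    simpa using (hasDerivAt_pow 2 y).add_const (a ^ 2)
  have h3 := ((hasDerivAt_id y).div_const a).arctan.const_mul a
  refine (((h1.div h2 h0).add h3).div_const 2).congr_deriv ?_
  have h4 : 1 + (y / a) ^ 2 ≠ 0 := by positivity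
  simp only [cutoff, id]
  field_simp
  ring

theorem cutoffPrim_zero (a : ℝ) : cutoffPrim a 0 = 0 := by simp [cutoffPrim]

theorem tendsto_cutoffPrim {a : ℝ} (ha : 0 < a) :
    Tendsto (cutoffPrim a) atTop (𝓝 (a * Real.pi / 4)) := by
  have h1 : Tendsto (fun y : ℝ => a * Real.arctan (y / a)) atTop (𝓝 (a * (Real.pi / 2))) :=
    (((Real.tendsto_arctan_atTop).mono_right nhdsWithin_le_nhds).comp
      (tendsto_id.atTop_div_const ha)).const_mul a
  have h2 : Tendsto (fun y : ℝ => a ^ 2 * y / (y ^ 2 + a ^ 2)) atTop (𝓝 0) := by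
    have h3 : Tendsto (fun y : ℝ => a ^ 2 / y) atTop (𝓝 0) :=
      tendsto_const_nhds.div_atTop tendsto_id
    refine squeeze_zero' ?_ ?_ h3
    · filter_upwards [eventually_ge_atTop 0] with y hy
      positivity
    · filter_upwards [eventually_gt_atTop 0] with y hy
      rw [div_le_div_iff₀ (by positivity) hy]
      nlinarith [sq_nonneg (a * a)]
  have h4 := (h2.add h1).div_const 2
  rw [show (0 + a * (Real.pi / 2)) / 2 = a * Real.pi / 4 by ring] at h4
  exact h4

theorem cutoffPrim_le {a : ℝ} (ha : 0 < a) (y : ℝ) : cutoffPrim a y ≤ a * Real.pi / 4 := by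
  have hmono : Monotone (cutoffPrim a) := monotone_of_deriv_nonneg
    (fun y => (hasDerivAt_cutoffPrim ha y).differentiableAt) fun y => by
      rw [(hasDerivAt_cutoffPrim ha y).deriv]; positivity
  exact hmono.ge_of_tendsto (tendsto_cutoffPrim ha) y

theorem integrableOn_cutoff_sq {a : ℝ} (ha : 0 < a) :
    IntegrableOn (fun y => cutoff a y ^ 2) (Set.Ioi 0) :=
  integrableOn_Ioi_deriv_of_nonneg' (fun y _ => hasDerivAt_cutoffPrim ha y)
    (fun _ _ => sq_nonneg _) (tendsto_cutoffPrim ha)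

theorem integral_cutoff_sq {a : ℝ} (ha : 0 < a) :
    ∫ y in Set.Ioi 0, cutoff a y ^ 2 = a * Real.pi / 4 := by
  rw [integral_Ioi_of_hasDerivAt_of_tendsto' (fun y _ => hasDerivAt_cutoffPrim ha y)
    (integrableOn_cutoff_sq ha) (tendsto_cutoffPrim ha), cutoffPrim_zero, sub_zero]

theorem integrableOn_cutoff_mul {a b : ℝ} (ha : 0 < a) (hb : 0 < b) :
    IntegrableOn (fun y => cutoff a y * cutoff b y) (Set.Ioi 0) := by
  refine Integrable.mono' ((integrableOn_cutoff_sq ha).add (integrableOn_cutoff_sq hb))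
    ((continuous_cutoff ha).mul (continuous_cutoff hb)).aestronglyMeasurable
    (Eventually.of_forall fun y => ?_)
  rw [Real.norm_eq_abs, abs_le]
  simp only [Pi.add_apply]
  constructor <;> nlinarith [sq_nonneg (cutoff a y + cutoff b y),
    sq_nonneg (cutoff a y - cutoff b y), sq_nonneg (cutoff a y), sq_nonneg (cutoff b y)]

/-- Each degree is dominated by the integral over the interval `[n (n + 2), (n + 1) (n + 3)]`, of
length `2 n + 3`: the integrand is a convex function of `y²`, and the mean of `y²` over this
interval is less than `(n + 1)² (n + 2)²`. -/
theorem mul_cutoff_sq_le {a : ℝ} (ha : 0 < a) (n : ℕ) :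
    (2 * n + 3) * cutoff a (eig n) ^ 2
      ≤ cutoffPrim a (((n + 1 : ℕ) : ℝ) * ((n + 1 : ℕ) + 2)) - cutoffPrim a (n * (n + 2)) := by
  set l := eig n with hl
  have hl2 : 2 ≤ l := by
    rw [hl, eig]
    nlinarith [(Nat.cast_nonneg n : (0 : ℝ) ≤ n)]
  set z := l ^ 2 + a ^ 2 with hz
  have hz0 : 0 < z := by positivity
  -- A primitive of the tangent at `y² = l²` of the integrand, regarded as a function of `y²`.
  set G : ℝ → ℝ := fun y =>
    a ^ 4 / z ^ 2 * y - 2 * (a ^ 4 / z ^ 3) * (y ^ 3 / 3 - l ^ 2 * y) with hG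
  have hGd (y : ℝ) : HasDerivAt G (a ^ 4 / z ^ 2 - 2 * (a ^ 4 / z ^ 3) * (y ^ 2 - l ^ 2)) y := by
    have h1 : HasDerivAt (fun y : ℝ => a ^ 4 / z ^ 2 * y) (a ^ 4 / z ^ 2) y := by
      simpa using (hasDerivAt_id y).const_mul (a ^ 4 / z ^ 2)
    have h2 : HasDerivAt (fun y : ℝ => y ^ 3 / 3 - l ^ 2 * y) (y ^ 2 - l ^ 2) y := by
      have h3 := ((hasDerivAt_pow 3 y).div_const 3).sub ((hasDerivAt_id y).const_mul (l ^ 2))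
      refine h3.congr_deriv ?_
      simp
    exact h1.sub (h2.const_mul _)
  have hmono : Monotone fun y => cutoffPrim a y - G y := by
    refine monotone_of_deriv_nonneg
      (fun y => ((hasDerivAt_cutoffPrim ha y).sub (hGd y)).differentiableAt) fun y => ?_
    rw [((hasDerivAt_cutoffPrim ha y).fun_sub (hGd y)).deriv]
    set t := y ^ 2 + a ^ 2 with ht
    have ht0 : 0 < t := by positivity
    -- The tangent line at `z` lies below the convex function `t ↦ t⁻²`.
    have key : cutoff a y ^ 2 - (a ^ 4 / z ^ 2 - 2 * (a ^ 4 / z ^ 3) * (y ^ 2 - l ^ 2))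
        = a ^ 4 * ((t - z) ^ 2 * (2 * t + z)) / (t ^ 2 * z ^ 3) := by
      rw [cutoff, ← ht, show y ^ 2 - l ^ 2 = t - z by rw [ht, hz]; ring]
      field_simp
      ring
    rw [key]
    positivity
  have hle : (n : ℝ) * (n + 2) ≤ ((n + 1 : ℕ) : ℝ) * ((n + 1 : ℕ) + 2) := by
    push_cast
    nlinarith [(Nat.cast_nonneg n : (0 : ℝ) ≤ n)]
  have h := hmono hle
  have hGdiff : G (((n + 1 : ℕ) : ℝ) * ((n + 1 : ℕ) + 2)) - G (n * (n + 2))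
      = (2 * n + 3) * (a ^ 4 / z ^ 2)
        + 2 * (a ^ 4 / z ^ 3) * ((2 * n + 3) * (2 * l - 1) / 3) := by
    simp only [hG, hl, eig]
    push_cast
    ring
  have hpos : 0 ≤ 2 * (a ^ 4 / z ^ 3) * ((2 * n + 3) * (2 * l - 1) / 3) := by
    have : 0 ≤ 2 * l - 1 := by linarith
    positivity
  have hc : cutoff a l ^ 2 = a ^ 4 / z ^ 2 := by
    rw [cutoff, div_pow]
    ring
  rw [hc]
  simp only at h
  linarith

theorem sum_mul_cutoff_sq_le {a : ℝ} (ha : 0 < a) (M : ℕ) :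
    ∑ n ∈ Finset.range M, (2 * n + 3) * cutoff a (eig n) ^ 2 ≤ a * Real.pi / 4 := by
  refine (Finset.sum_le_sum fun n _ => mul_cutoff_sq_le ha n).trans ?_
  rw [Finset.sum_range_sub (fun n : ℕ => cutoffPrim a ((n : ℝ) * (n + 2)))]
  simpa [cutoffPrim_zero] using cutoffPrim_le ha _

/-! ### The pointwise inequality -/

theorem integral_sub_sqrt_sq {R A : ℝ} (hR : 0 ≤ R) (hA : 0 < A) :
    ∫ E in (0 : ℝ)..R ^ 2 / A, (R - √(A * E)) ^ 2 = R ^ 4 / (6 * A) := by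
  have hT : 0 ≤ R ^ 2 / A := by positivity
  have hd : ∀ E ∈ Set.Ioo 0 (R ^ 2 / A), HasDerivAt
      (fun E => R ^ 2 * E - 4 / 3 * R * (E * √(A * E)) + A / 2 * E ^ 2)
      ((R - √(A * E)) ^ 2) E := by
    intro E hE
    have hAE : 0 < A * E := mul_pos hA hE.1
    have h1 : HasDerivAt (fun E : ℝ => A * E) A E := by
      simpa using (hasDerivAt_id E).const_mul A
    have h2 := (hasDerivAt_id E).mul (h1.sqrt hAE.ne')
    have h3 := (((hasDerivAt_id E).const_mul (R ^ 2)).sub (h2.const_mul (4 / 3 * R))).add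
      ((hasDerivAt_pow 2 E).const_mul (A / 2))
    refine h3.congr_deriv ?_
    have hs := Real.sq_sqrt hAE.le
    have hs0 : √(A * E) ≠ 0 := (Real.sqrt_pos.mpr hAE).ne'
    have h4 : E * (A / (2 * √(A * E))) = √(A * E) / 2 := by
      rw [mul_div_assoc', mul_comm E A, div_eq_div_iff (by positivity) two_ne_zero]
      linear_combination -2 * hs
    simp only [id, h4]
    push_cast
    linear_combination -hs
  rw [intervalIntegral.integral_eq_sub_of_hasDerivAt_of_le hT (by fun_prop) hd
    (Continuous.intervalIntegrable (by fun_prop) _ _)]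
  have hs : √(A * (R ^ 2 / A)) = R := by
    rw [mul_div_cancel₀ _ hA.ne', Real.sqrt_sq hR]
  rw [hs]
  field_simp
  ring

section

variable {κ V : Type*} [NormedAddCommGroup V] [InnerProductSpace ℝ V]

theorem norm_sq_sum_smul (K : Finset κ) (a : κ → ℝ) (v : κ → V) :
    ‖∑ k ∈ K, a k • v k‖ ^ 2 = ∑ k ∈ K, ∑ l ∈ K, a k * a l * inner ℝ (v k) (v l) := by
  rw [← real_inner_self_eq_norm_sq, sum_inner]
  refine Finset.sum_congr rfl fun k _ => ?_
  rw [inner_sum]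
  refine Finset.sum_congr rfl fun l _ => ?_
  rw [real_inner_smul_left, real_inner_smul_right, mul_assoc]

theorem integrableOn_norm_sq_sum_cutoff (K : Finset κ) {a : κ → ℝ} (ha : ∀ k, 0 < a k) (v : κ → V) :
    IntegrableOn (fun E => ‖∑ k ∈ K, cutoff (a k) E • v k‖ ^ 2) (Set.Ioi 0) := by
  simp only [norm_sq_sum_smul]
  exact integrable_finsetSum _ fun k _ => integrable_finsetSum _ fun l _ =>
    (integrableOn_cutoff_mul (ha k) (ha l)).mul_const _

theorem integral_norm_sq_sum_cutoff (K : Finset κ) {a : κ → ℝ} (ha : ∀ k, 0 < a k) (v : κ → V) :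
    ∫ E in Set.Ioi 0, ‖∑ k ∈ K, cutoff (a k) E • v k‖ ^ 2
      = ∑ k ∈ K, ∑ l ∈ K, (∫ E in Set.Ioi 0, cutoff (a k) E * cutoff (a l) E)
          * inner ℝ (v k) (v l) := by
  have hint (k l : κ) := (integrableOn_cutoff_mul (ha k) (ha l)).mul_const (inner ℝ (v k) (v l))
  simp only [norm_sq_sum_smul]
  rw [integral_finsetSum _ fun k _ => integrable_finsetSum _ fun l _ => hint k l]
  refine Finset.sum_congr rfl fun k _ => ?_
  rw [integral_finsetSum _ fun l _ => hint k l]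
  exact Finset.sum_congr rfl fun l _ => integral_mul_const _ _

/-- If the part of `∑ vₖ` removed by the cut-off at energy `E` has squared norm at most `A E`, then
the energy is bounded below by `‖∑ vₖ‖⁴ / (6 A)`. -/
theorem norm_pow_four_le (K : Finset κ) {l : κ → ℝ} (hl : ∀ k, 0 < l k) (v : κ → V) {A : ℝ}
    (hA : 0 < A)
    (h : ∀ E, 0 < E → ‖∑ k ∈ K, cutoff (Real.pi * E / 4) (l k) • v k‖ ^ 2 ≤ A * E) :
    ‖∑ k ∈ K, v k‖ ^ 4
      ≤ 6 * A * ∫ E in Set.Ioi 0, ‖∑ k ∈ K, cutoff (4 * l k / Real.pi) E • v k‖ ^ 2 := by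
  set R := ‖∑ k ∈ K, v k‖ with hR
  have hR0 : 0 ≤ R := norm_nonneg _
  have hpi := Real.pi_pos
  have hint := integrableOn_norm_sq_sum_cutoff K (a := fun k => 4 * l k / Real.pi)
    (fun k => div_pos (mul_pos four_pos (hl k)) hpi) v
  have hT : 0 ≤ R ^ 2 / A := by positivity
  have hpt : ∀ E ∈ Set.Ioc 0 (R ^ 2 / A), (R - √(A * E)) ^ 2
      ≤ ‖∑ k ∈ K, cutoff (4 * l k / Real.pi) E • v k‖ ^ 2 := by
    intro E hE
    have h1 : ‖∑ k ∈ K, cutoff (Real.pi * E / 4) (l k) • v k‖ ≤ √(A * E) :=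
      Real.le_sqrt_of_sq_le (h E hE.1)
    have h2 : ∑ k ∈ K, v k = ∑ k ∈ K, cutoff (4 * l k / Real.pi) E • v k
        + ∑ k ∈ K, cutoff (Real.pi * E / 4) (l k) • v k := by
      rw [← Finset.sum_add_distrib]
      refine Finset.sum_congr rfl fun k _ => ?_
      rw [← one_sub_cutoff (hl k), ← add_smul, add_sub_cancel, one_smul]
    have h3 : R ≤ ‖∑ k ∈ K, cutoff (4 * l k / Real.pi) E • v k‖ + √(A * E) := by
      rw [hR, h2]
      exact (norm_add_le _ _).trans (by gcongr)
    have h4 : √(A * E) ≤ R := by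
      rw [Real.sqrt_le_left hR0]
      have := (le_div_iff₀ hA).mp hE.2
      linarith
    exact pow_le_pow_left₀ (by linarith) (by linarith) 2
  have h5 : R ^ 4 / (6 * A)
      ≤ ∫ E in Set.Ioi 0, ‖∑ k ∈ K, cutoff (4 * l k / Real.pi) E • v k‖ ^ 2 := by
    rw [← integral_sub_sqrt_sq hR0 hA, intervalIntegral.integral_of_le hT]
    calc ∫ E in Set.Ioc 0 (R ^ 2 / A), (R - √(A * E)) ^ 2
        ≤ ∫ E in Set.Ioc 0 (R ^ 2 / A), ‖∑ k ∈ K, cutoff (4 * l k / Real.pi) E • v k‖ ^ 2 :=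
          setIntegral_mono_on
            ((Continuous.integrableOn_Icc (by fun_prop)).mono_set Set.Ioc_subset_Icc_self)
            (hint.mono_set Set.Ioc_subset_Ioi_self) measurableSet_Ioc hpt
      _ ≤ _ := setIntegral_mono_set hint (Eventually.of_forall fun E => sq_nonneg _)
          Set.Ioc_subset_Ioi_self.eventuallyLE
  rwa [div_le_iff₀' (by positivity)] at h5

end

/-! ### The inequality for partial sums -/

/-- The coefficient of `u` at a vector spherical harmonic. -/
noncomputable def coef (u : Lp E3 2 dS) (k : HarmIdx) : ℝ := inner ℝ (fieldL2 (vecHarm k)) u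

/-- The partial sum over `K` of the expansion of `u` in vector spherical harmonics. -/
noncomputable def partialSum (u : Lp E3 2 dS) (K : Finset HarmIdx) : C(S2, E3) :=
  ∑ k ∈ K, coef u k • vecHarm k

theorem partialSum_apply (u : Lp E3 2 dS) (K : Finset HarmIdx) (s : S2) :
    partialSum u K s = ∑ k ∈ K, coef u k • vecHarm k s := by
  simp [partialSum]

/-- Bessel's inequality for an orthonormal family of fields, tested at a point of the sphere. -/
theorem sum_norm_sq_sum_coef_le {N : ℕ} {u : Fin N → Lp E3 2 dS} (hu : Orthonormal ℝ u)
    (K : Finset HarmIdx) (w : HarmIdx → ℝ) (s : S2) :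
    ∑ j, ‖∑ k ∈ K, (w k * coef (u j) k) • vecHarm k s‖ ^ 2
      ≤ ∑ k ∈ K, w k ^ 2 * ‖vecHarm k s‖ ^ 2 := by
  let V (a : Fin 3) : Lp E3 2 dS := ∑ k ∈ K, (w k * vecHarm k s a) • fieldL2 (vecHarm k)
  -- The `a`-th component at `s` of the weighted expansion of `u j` is the inner product with `V a`.
  have hV (a : Fin 3) : ‖V a‖ ^ 2 = ∑ k ∈ K, (w k * vecHarm k s a) ^ 2 := by
    rw [← real_inner_self_eq_norm_sq, orthonormal_vecHarm.inner_sum]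
    simp [sq]
  have hin (a : Fin 3) (j : Fin N) : (∑ k ∈ K, (w k * coef (u j) k) • vecHarm k s) a
      = inner ℝ (u j) (V a) := by
    rw [inner_sum]
    simp only [WithLp.ofLp_sum, Finset.sum_apply, PiLp.smul_apply, smul_eq_mul,
      real_inner_smul_right, coef]
    refine Finset.sum_congr rfl fun k _ => ?_
    rw [real_inner_comm]
    ring
  calc ∑ j, ‖∑ k ∈ K, (w k * coef (u j) k) • vecHarm k s‖ ^ 2
      = ∑ a, ∑ j, ‖(inner ℝ (u j) (V a) : ℝ)‖ ^ 2 := by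
        rw [Finset.sum_comm]
        refine Finset.sum_congr rfl fun j _ => ?_
        rw [EuclideanSpace.norm_sq_eq]
        exact Finset.sum_congr rfl fun a _ => by rw [hin]
    _ ≤ ∑ a, ‖V a‖ ^ 2 := Finset.sum_le_sum fun a _ => hu.sum_inner_products_le (V a)
    _ = ∑ k ∈ K, w k ^ 2 * ‖vecHarm k s‖ ^ 2 := by
        simp only [hV]
        rw [Finset.sum_comm]
        refine Finset.sum_congr rfl fun k _ => ?_
        rw [EuclideanSpace.norm_sq_eq, Finset.mul_sum]
        exact Finset.sum_congr rfl fun a _ => by rw [mul_pow, Real.norm_eq_abs, sq_abs]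

theorem sum_harmIdxLE (B : Finset Bool) (M : ℕ) (f : HarmIdx → ℝ) :
    ∑ k ∈ harmIdxLE B M, f k = ∑ b ∈ B, ∑ n ∈ Finset.range M, ∑ i, f (b, ⟨n, i⟩) := by
  rw [harmIdxLE, Finset.sum_product]
  exact Finset.sum_congr rfl fun b _ => Finset.sum_sigma _ _ _

theorem sum_cutoff_sq_mul_norm_sq_le (B : Finset Bool) (M : ℕ) {E : ℝ} (hE : 0 < E) (s : S2) :
    ∑ k ∈ harmIdxLE B M, cutoff (Real.pi * E / 4) (eig k.2.1) ^ 2 * ‖vecHarm k s‖ ^ 2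
      ≤ B.card * Real.pi / 64 * E := by
  have hpi := Real.pi_pos
  rw [sum_harmIdxLE]
  have hb (b : Bool) : ∑ n ∈ Finset.range M, ∑ i,
      cutoff (Real.pi * E / 4) (eig n) ^ 2 * ‖vecHarm (b, ⟨n, i⟩) s‖ ^ 2
        ≤ Real.pi / 64 * E := by
    calc _ ≤ ∑ n ∈ Finset.range M,
          (4 * Real.pi)⁻¹ * ((2 * n + 3) * cutoff (Real.pi * E / 4) (eig n) ^ 2) := by
          refine Finset.sum_le_sum fun n _ => ?_
          rw [← Finset.mul_sum]
          refine (mul_le_mul_of_nonneg_left (sum_norm_sq_vecHarm b n s) (sq_nonneg _)).trans_eq ?_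
          rw [div_eq_mul_inv]
          ring
      _ ≤ (4 * Real.pi)⁻¹ * (Real.pi * E / 4 * Real.pi / 4) := by
          rw [← Finset.mul_sum]
          gcongr
          exact sum_mul_cutoff_sq_le (by positivity) M
      _ = Real.pi / 64 * E := by
          field_simp
          ring
  refine (Finset.sum_le_sum fun b _ => hb b).trans_eq ?_
  rw [Finset.sum_const, nsmul_eq_mul]
  ring

theorem sum_norm_sq_pow_two_le {N : ℕ} {u : Fin N → Lp E3 2 dS} (hu : Orthonormal ℝ u)
    {B : Finset Bool} (hB : B.Nonempty) (M : ℕ) (s : S2) :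
    (∑ j, ‖partialSum (u j) (harmIdxLE B M) s‖ ^ 2) ^ 2
      ≤ 6 * (B.card * Real.pi / 64) * ∑ k ∈ harmIdxLE B M, ∑ l ∈ harmIdxLE B M,
          (∫ E in Set.Ioi 0,
            cutoff (4 * eig k.2.1 / Real.pi) E * cutoff (4 * eig l.2.1 / Real.pi) E) *
            ∑ j, coef (u j) k * coef (u j) l * inner ℝ (vecHarm k s) (vecHarm l s) := by
  have hpi := Real.pi_pos
  have hcard : (0 : ℝ) < B.card := by exact_mod_cast hB.card_pos
  set K := harmIdxLE B M
  -- The values at `s` of all the fields, gathered in a single euclidean vector.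
  let v (k : HarmIdx) : PiLp 2 fun _ : Fin N => E3 :=
    WithLp.toLp 2 fun j => coef (u j) k • vecHarm k s
  have hnorm (a : HarmIdx → ℝ) : ‖∑ k ∈ K, a k • v k‖ ^ 2
      = ∑ j, ‖∑ k ∈ K, (a k * coef (u j) k) • vecHarm k s‖ ^ 2 := by
    rw [PiLp.norm_sq_eq_of_L2]
    simp [v, mul_smul]
  have h1 := norm_pow_four_le K (l := fun k => eig k.2.1) (fun k => eig_pos _) v
    (A := B.card * Real.pi / 64) (by positivity) fun E hE => by
      rw [hnorm]
      exact (sum_norm_sq_sum_coef_le hu K _ s).trans (sum_cutoff_sq_mul_norm_sq_le B M hE s)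
  have h2 : ‖∑ k ∈ K, v k‖ ^ 4 = (∑ j, ‖partialSum (u j) K s‖ ^ 2) ^ 2 := by
    have := hnorm fun _ => 1
    simp only [one_smul, one_mul, ← partialSum_apply] at this
    rw [← this]
    ring
  rw [integral_norm_sq_sum_cutoff K (a := fun k => 4 * eig k.2.1 / Real.pi)
    (fun k => div_pos (mul_pos four_pos (eig_pos _)) hpi), h2] at h1
  refine h1.trans_eq ?_
  congr 1
  refine Finset.sum_congr rfl fun k _ => Finset.sum_congr rfl fun l _ => ?_
  congr 1
  rw [PiLp.inner_apply]
  refine Finset.sum_congr rfl fun j _ => ?_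
  change inner ℝ (coef (u j) k • vecHarm k s) (coef (u j) l • vecHarm l s) = _
  rw [real_inner_smul_left, real_inner_smul_right, mul_assoc]

/-- The Lieb–Thirring inequality for partial sums. -/
theorem integral_partialSum_le {N : ℕ} {u : Fin N → Lp E3 2 dS} (hu : Orthonormal ℝ u)
    {B : Finset Bool} (hB : B.Nonempty) (M : ℕ) :
    ∫ s, (∑ j, ‖partialSum (u j) (harmIdxLE B M) s‖ ^ 2) ^ 2 ∂dS
      ≤ 3 * Real.pi / 32 * B.card *
        ∑ j, ∑ k ∈ harmIdxLE B M, eig k.2.1 * coef (u j) k ^ 2 := by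
  have hpi := Real.pi_pos
  set K := harmIdxLE B M
  set W : HarmIdx → HarmIdx → ℝ := fun k l =>
    ∫ E in Set.Ioi 0, cutoff (4 * eig k.2.1 / Real.pi) E * cutoff (4 * eig l.2.1 / Real.pi) E
  have hin (k l : HarmIdx) : Integrable (fun s => inner ℝ (vecHarm k s) (vecHarm l s)) dS :=
    integrable_continuousMap ⟨fun s => inner ℝ (vecHarm k s) (vecHarm l s), by fun_prop⟩
  have hint (k l : HarmIdx) : Integrable (fun s => W k l *
      ∑ j, coef (u j) k * coef (u j) l * inner ℝ (vecHarm k s) (vecHarm l s)) dS :=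
    (integrable_finsetSum _ fun j _ => (hin k l).const_mul _).const_mul _
  have hval (k l : HarmIdx) : ∫ s, W k l *
      ∑ j, coef (u j) k * coef (u j) l * inner ℝ (vecHarm k s) (vecHarm l s) ∂dS
        = if k = l then ∑ j, eig k.2.1 * coef (u j) k ^ 2 else 0 := by
    rw [integral_const_mul, integral_finsetSum _ fun j _ => (hin k l).const_mul _]
    simp only [integral_const_mul, integral_inner_vecHarm]
    by_cases hkl : k = l
    · subst hkl
      have hW : W k k = eig k.2.1 := by
        simp only [W, ← sq]
        rw [integral_cutoff_sq (div_pos (mul_pos four_pos (eig_pos _)) hpi)]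
        field_simp
      simp only [if_true, hW, mul_one, Finset.mul_sum, sq]
    · simp [hkl]
  calc _ ≤ ∫ s, 6 * (B.card * Real.pi / 64) * ∑ k ∈ K, ∑ l ∈ K, W k l *
        ∑ j, coef (u j) k * coef (u j) l * inner ℝ (vecHarm k s) (vecHarm l s) ∂dS := by
        refine integral_mono ?_ ?_ fun s => sum_norm_sq_pow_two_le hu hB M s
        · exact integrable_continuousMap
            ⟨fun s => (∑ j, ‖partialSum (u j) K s‖ ^ 2) ^ 2, by fun_prop⟩
        · exact (integrable_finsetSum _ fun k _ => integrable_finsetSum _ fun l _ =>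
            hint k l).const_mul _
    _ = _ := by
        rw [integral_const_mul, integral_finsetSum _ fun k _ => integrable_finsetSum _ fun l _ =>
          hint k l]
        have hk (k : HarmIdx) (hk : k ∈ K) : ∫ s, ∑ l ∈ K, W k l *
            ∑ j, coef (u j) k * coef (u j) l * inner ℝ (vecHarm k s) (vecHarm l s) ∂dS
              = ∑ j, eig k.2.1 * coef (u j) k ^ 2 := by
          rw [integral_finsetSum _ fun l _ => hint k l]
          simp only [hval]
          simp [hk]
        rw [Finset.sum_congr rfl hk, Finset.sum_comm]
        ring

/-! ### Passage to the limit -/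

/-- Finitely many sequences that converge in `L²` have a common subsequence that converges almost
everywhere. -/
theorem exists_subseq_tendsto_ae {ι : Type*} (t : Finset ι) {f : ι → ℕ → Lp E3 2 dS}
    {g : ι → Lp E3 2 dS} (h : ∀ j, Tendsto (f j) atTop (𝓝 (g j))) :
    ∃ ns : ℕ → ℕ, StrictMono ns ∧
      ∀ j ∈ t, ∀ᵐ s ∂dS, Tendsto (fun i => f j (ns i) s) atTop (𝓝 (g j s)) := by
  classical
  induction t using Finset.induction_on with
  | empty => exact ⟨id, strictMono_id, by simp⟩
  | insert j t _ ih =>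
    obtain ⟨ns, hns, hae⟩ := ih
    obtain ⟨ms, hms, hae'⟩ := (tendstoInMeasure_of_tendsto_Lp
      ((h j).comp hns.tendsto_atTop)).exists_seq_tendsto_ae
    refine ⟨ns ∘ ms, hns.comp hms, fun i hi => ?_⟩
    rcases Finset.mem_insert.mp hi with rfl | hi
    · exact hae'
    · filter_upwards [hae i hi] with s hs
      exact hs.comp hms.tendsto_atTop

/-- A form of Fatou's lemma. -/
theorem integrable_and_integral_le_of_tendsto {F : ℕ → S2 → ℝ} {f : S2 → ℝ} {c : ℝ}
    (hF : ∀ n, Integrable (F n) dS) (hF0 : ∀ n s, 0 ≤ F n s)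
    (hlim : ∀ᵐ s ∂dS, Tendsto (fun n => F n s) atTop (𝓝 (f s)))
    (hc : ∀ n, ∫ s, F n s ∂dS ≤ c) : Integrable f dS ∧ ∫ s, f s ∂dS ≤ c := by
  have hc0 : 0 ≤ c := (integral_nonneg (hF0 0)).trans (hc 0)
  have hf0 : 0 ≤ᵐ[dS] f := by
    filter_upwards [hlim] with s hs
    exact ge_of_tendsto' hs fun n => hF0 n s
  have hfm : AEStronglyMeasurable f dS := aestronglyMeasurable_of_tendsto_ae atTop
    (fun n => (hF n).aestronglyMeasurable) hlim
  have hle : ∫⁻ s, ENNReal.ofReal (f s) ∂dS ≤ ENNReal.ofReal c := by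
    calc ∫⁻ s, ENNReal.ofReal (f s) ∂dS
        = ∫⁻ s, liminf (fun n => ENNReal.ofReal (F n s)) atTop ∂dS := by
          refine lintegral_congr_ae ?_
          filter_upwards [hlim] with s hs
          exact ((ENNReal.continuous_ofReal.tendsto _).comp hs).liminf_eq.symm
      _ ≤ liminf (fun n => ∫⁻ s, ENNReal.ofReal (F n s) ∂dS) atTop :=
          lintegral_liminf_le' fun n => (hF n).aestronglyMeasurable.aemeasurable.ennreal_ofReal
      _ ≤ ENNReal.ofReal c := by
          refine liminf_le_of_le (by isBoundedDefault) fun b hb => ?_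
          obtain ⟨n, hn⟩ := hb.exists
          refine hn.trans ?_
          rw [← ofReal_integral_eq_lintegral_ofReal (hF n) (Eventually.of_forall (hF0 n))]
          exact ENNReal.ofReal_le_ofReal (hc n)
  have hfi : Integrable f dS := by
    refine ⟨hfm, ?_⟩
    rw [hasFiniteIntegral_iff_ofReal hf0]
    exact hle.trans_lt ENNReal.ofReal_lt_top
  refine ⟨hfi, ?_⟩
  rw [← ofReal_integral_eq_lintegral_ofReal hfi hf0] at hle
  exact (ENNReal.ofReal_le_ofReal_iff hc0).mp hle

/-- The Lieb–Thirring inequality for tangent fields whose expansion contains only the kinds of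
vector spherical harmonics in `B`, with `D j` a bound of the Dirichlet form. -/
theorem integrable_and_integral_le_of_coef {N : ℕ} {u : Fin N → Lp E3 2 dS} (hu : Orthonormal ℝ u)
    (htan : ∀ j, u j ∈ tangentL2) {B : Finset Bool} (hB : B.Nonempty)
    (hcoef : ∀ j k, k.1 ∉ B → coef (u j) k = 0) {D : Fin N → ℝ}
    (hD : ∀ j M, ∑ k ∈ harmIdxLE B M, eig k.2.1 * coef (u j) k ^ 2 ≤ D j) :
    Integrable (fun s => (∑ j, ‖u j s‖ ^ 2) ^ 2) dS ∧
      ∫ s, (∑ j, ‖u j s‖ ^ 2) ^ 2 ∂dS ≤ 3 * Real.pi / 32 * B.card * ∑ j, D j := by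
  have hpi := Real.pi_pos
  have hsum (j : Fin N) (M : ℕ) : ∑ k ∈ harmIdxLE Finset.univ M,
      inner ℝ (fieldL2 (vecHarm k)) (u j) • fieldL2 (vecHarm k)
        = fieldL2 (partialSum (u j) (harmIdxLE B M)) := by
    rw [partialSum, map_sum]
    simp only [map_smul]
    refine (Finset.sum_subset (Finset.product_subset_product_left (Finset.subset_univ B))
      fun k hk hkB => ?_).symm
    have : k.1 ∉ B := fun h => hkB (Finset.mem_product.mpr ⟨h, (Finset.mem_product.mp hk).2⟩)
    change coef (u j) k • _ = 0
    rw [hcoef j k this, zero_smul]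
  obtain ⟨ns, -, hns⟩ := exists_subseq_tendsto_ae Finset.univ fun j => tendsto_sum_vecHarm (htan j)
  refine integrable_and_integral_le_of_tendsto
    (F := fun i s => (∑ j, ‖partialSum (u j) (harmIdxLE B (ns i)) s‖ ^ 2) ^ 2)
    (fun i => integrable_continuousMap
      ⟨fun s => (∑ j, ‖partialSum (u j) (harmIdxLE B (ns i)) s‖ ^ 2) ^ 2, by fun_prop⟩)
    (fun i s => sq_nonneg _) ?_ fun i => (integral_partialSum_le hu hB (ns i)).trans ?_
  · have h1 : ∀ᵐ s ∂dS, ∀ j, Tendsto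
        (fun i => partialSum (u j) (harmIdxLE B (ns i)) s) atTop (𝓝 (u j s)) := by
      rw [ae_all_iff]
      intro j
      have h2 : ∀ᵐ s ∂dS, ∀ i, fieldL2 (partialSum (u j) (harmIdxLE B (ns i))) s
          = partialSum (u j) (harmIdxLE B (ns i)) s :=
        ae_all_iff.mpr fun i => ContinuousMap.coeFn_toLp dS _
      filter_upwards [hns j (Finset.mem_univ j), h2] with s hs h2
      simp only [hsum, h2] at hs
      exact hs
    filter_upwards [h1] with s hs
    exact (tendsto_finsetSum _ fun j _ => (hs j).norm.pow 2).pow 2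
  · gcongr with j
    exact hD j _

/-! ### Divergence and rotation -/

/-- The rotation or the divergence of a field: the function whose scalar coefficients give the
coefficients of the field at the vector spherical harmonics of a given kind. -/
noncomputable def rotOrDiv (b : Bool) (u : S2 → E3) : S2 → ℝ := bif b then divS u else rotS u

theorem IsH1Field.isWeakDiv_divS {u : S2 → E3} (hu : IsH1Field u) : IsWeakDiv u (divS u) :=
  divS_spec hu.exists_isWeakDiv.choose_spec

theorem IsH1Field.isWeakDiv_rotS {u : S2 → E3} (hu : IsH1Field u) : IsWeakDiv (perp u) (rotS u) :=
  divS_spec hu.exists_isWeakDiv_perp.choose_spec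

theorem IsH1Field.memLp_rotOrDiv {u : S2 → E3} (hu : IsH1Field u) (b : Bool) :
    MemLp (rotOrDiv b u) 2 dS := by
  cases b
  · exact hu.isWeakDiv_rotS.memLp
  · exact hu.isWeakDiv_divS.memLp

theorem IsH1Field.eig_mul_coef_sq {u : S2 → E3} (hu : IsH1Field u) (k : HarmIdx) :
    eig k.2.1 * coef (hu.1.memLp.toLp u) k ^ 2
      = inner ℝ (resL2 (harm k.2.1 k.2.2)) ((hu.memLp_rotOrDiv k.1).toLp _) ^ 2 := by
  have he := eig_pos k.2.1
  have h1 : coef (hu.1.memLp.toLp u) k = (√(eig k.2.1))⁻¹ *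
      ∫ s, inner ℝ (tangentField k.1 (harm k.2.1 k.2.2) s) (u s) ∂dS := by
    rw [coef, inner_fieldL2, ← integral_const_mul]
    refine integral_congr_ae ?_
    filter_upwards [hu.1.memLp.coeFn_toLp] with s hs
    rw [hs, vecHarm, ContinuousMap.smul_apply, real_inner_smul_left]
  have h2 : inner ℝ (resL2 (harm k.2.1 k.2.2)) ((hu.memLp_rotOrDiv k.1).toLp _)
      = ∫ s, rotOrDiv k.1 u s * res (harm k.2.1 k.2.2) s ∂dS := by
    rw [L2.inner_def]
    refine integral_congr_ae ?_
    filter_upwards [coeFn_resL2 (harm k.2.1 k.2.2), (hu.memLp_rotOrDiv k.1).coeFn_toLp]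
      with s h3 h4
    rw [h3, h4]
    simp
  rw [h1, h2, mul_pow, inv_pow, Real.sq_sqrt he.le, mul_inv_cancel_left₀ he.ne']
  obtain ⟨b, n, i⟩ := k
  cases b
  · rw [hu.isWeakDiv_rotS.integral_inner_tangentField_false, neg_sq]
    rfl
  · rw [hu.isWeakDiv_divS.integral_inner_tangentField_true hu.1.tangent]
    rfl

theorem IsH1Field.sum_eig_mul_coef_sq_le {u : S2 → E3} (hu : IsH1Field u) (B : Finset Bool)
    (M : ℕ) : ∑ k ∈ harmIdxLE B M, eig k.2.1 * coef (hu.1.memLp.toLp u) k ^ 2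
      ≤ ∑ b ∈ B, ∫ s, rotOrDiv b u s ^ 2 ∂dS := by
  simp only [hu.eig_mul_coef_sq]
  rw [harmIdxLE, Finset.sum_product]
  refine Finset.sum_le_sum fun b _ => ?_
  have h := orthonormal_harm.sum_inner_products_le ((hu.memLp_rotOrDiv b).toLp _)
    (s := (Finset.range M).sigma fun _ => Finset.univ)
  simp only [Real.norm_eq_abs, sq_abs] at h
  refine h.trans_eq ?_
  rw [← real_inner_self_eq_norm_sq, L2.inner_def]
  refine integral_congr_ae ?_
  filter_upwards [(hu.memLp_rotOrDiv b).coeFn_toLp] with s hs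
  rw [hs]
  simp [sq]

theorem IsL2Field.toLp_mem_tangentL2 {u : S2 → E3} (hu : IsL2Field u) :
    hu.memLp.toLp u ∈ tangentL2 := by
  rw [mem_tangentL2_iff]
  intro p
  rw [inner_fieldL2]
  refine integral_eq_zero_of_ae ?_
  filter_upwards [hu.memLp.coeFn_toLp, hu.tangent] with s hs ht
  rw [hs, normalField_apply, real_inner_smul_left, real_inner_comm, ht, mul_zero]
  rfl

/-- The Lieb–Thirring inequality with the constant `3 π / 32` for each kind of vector spherical
harmonics that occurs. -/
theorem integrable_and_integral_le_rotOrDiv {N : ℕ} {u : Fin N → S2 → E3}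
    (hu : ∀ j, IsH1Field (u j))
    (horth : ∀ i j, ∫ s, inner ℝ (u i s) (u j s) ∂dS = if i = j then 1 else 0)
    {B : Finset Bool} (hB : B.Nonempty) (h0 : ∀ j, ∀ b ∉ B, rotOrDiv b (u j) =ᵐ[dS] 0) :
    Integrable (fun s => (∑ j, ‖u j s‖ ^ 2) ^ 2) dS ∧
      ∫ s, (∑ j, ‖u j s‖ ^ 2) ^ 2 ∂dS
        ≤ 3 * Real.pi / 32 * B.card * ∑ j, ∑ b ∈ B, ∫ s, rotOrDiv b (u j) s ^ 2 ∂dS := by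
  set U : Fin N → Lp E3 2 dS := fun j => (hu j).1.memLp.toLp (u j) with hU
  have hUae : ∀ᵐ s ∂dS, ∀ j, U j s = u j s :=
    ae_all_iff.mpr fun j => (hu j).1.memLp.coeFn_toLp
  have hUo : Orthonormal ℝ U := by
    rw [orthonormal_iff_ite]
    intro i j
    rw [← horth i j, L2.inner_def]
    refine integral_congr_ae ?_
    filter_upwards [hUae] with s hs
    rw [hs, hs]
  have hcoef (j : Fin N) (k : HarmIdx) (hk : k.1 ∉ B) : coef (U j) k = 0 := by
    have h1 := (hu j).eig_mul_coef_sq k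
    have h2 : ((hu j).memLp_rotOrDiv k.1).toLp _ = 0 := by
      rw [Lp.eq_zero_iff_ae_eq_zero]
      exact ((hu j).memLp_rotOrDiv k.1).coeFn_toLp.trans (h0 j k.1 hk)
    rw [h2, inner_zero_right] at h1
    have h3 := (mul_eq_zero.mp (h1.trans (zero_pow two_ne_zero))).resolve_left (eig_pos _).ne'
    exact pow_eq_zero_iff two_ne_zero |>.mp h3
  have hae : (fun s => (∑ j, ‖U j s‖ ^ 2) ^ 2) =ᵐ[dS] fun s => (∑ j, ‖u j s‖ ^ 2) ^ 2 := by
    filter_upwards [hUae] with s hs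
    simp only [hs]
  obtain ⟨h1, h2⟩ := integrable_and_integral_le_of_coef hUo
    (fun j => (hu j).1.toLp_mem_tangentL2) hB hcoef
    fun j M => (hu j).sum_eig_mul_coef_sq_le B M
  exact ⟨h1.congr hae, by rwa [integral_congr_ae hae] at h2⟩

end SphereLT

theorem theorem2p2 (N : ℕ) (u : Fin N → SphereLT.S2 → SphereLT.E3)
    (hu : ∀ j, SphereLT.IsH1Field (u j))
    (horth : ∀ i j, ∫ s, inner ℝ (u i s) (u j s) ∂SphereLT.dS = if i = j then 1 else 0) :
    Integrable (fun s => (∑ j, ‖u j s‖ ^ 2) ^ 2) SphereLT.dS ∧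
    (∀ j, SphereLT.IsWeakDiv (u j) (SphereLT.divS (u j)) ∧
      SphereLT.IsWeakDiv (SphereLT.perp (u j)) (SphereLT.rotS (u j))) ∧
    ∫ s, (∑ j, ‖u j s‖ ^ 2) ^ 2 ∂SphereLT.dS
      ≤ 3 * Real.pi / 16 * ∑ j, ((∫ s, SphereLT.rotS (u j) s ^ 2 ∂SphereLT.dS)
          + ∫ s, SphereLT.divS (u j) s ^ 2 ∂SphereLT.dS) ∧
    ((∀ j, SphereLT.divS (u j) =ᵐ[SphereLT.dS] 0) →
      ∫ s, (∑ j, ‖u j s‖ ^ 2) ^ 2 ∂SphereLT.dS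
        ≤ 3 * Real.pi / 32 * ∑ j, ∫ s, SphereLT.rotS (u j) s ^ 2 ∂SphereLT.dS) ∧
    ((∀ j, SphereLT.rotS (u j) =ᵐ[SphereLT.dS] 0) →
      ∫ s, (∑ j, ‖u j s‖ ^ 2) ^ 2 ∂SphereLT.dS
        ≤ 3 * Real.pi / 32 * ∑ j, ∫ s, SphereLT.divS (u j) s ^ 2 ∂SphereLT.dS) := by
  have huniv := SphereLT.integrable_and_integral_le_rotOrDiv hu horth (B := Finset.univ)
    Finset.univ_nonempty (by simp)
  refine ⟨huniv.1, fun j => ⟨(hu j).isWeakDiv_divS, (hu j).isWeakDiv_rotS⟩, ?_, fun h => ?_,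
    fun h => ?_⟩
  · refine huniv.2.trans_eq ?_
    simp only [SphereLT.rotOrDiv, Fintype.sum_bool, cond_true, cond_false, Finset.card_univ,
      Fintype.card_bool, add_comm]
    push_cast
    ring
  · have := (SphereLT.integrable_and_integral_le_rotOrDiv hu horth (B := {false})
      (Finset.singleton_nonempty _) fun j b hb => by
        obtain rfl : b = true := by simpa using hb
        exact h j).2
    simpa [SphereLT.rotOrDiv] using this
  · have := (SphereLT.integrable_and_integral_le_rotOrDiv hu horth (B := {true})
      (Finset.singleton_nonempty _) fun j b hb => by
        obtain rfl : b = false := by simpa using hb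
        exact h j).2
    simpa [SphereLT.rotOrDiv] using this
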